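/- **Theorem.** For every integer $c_1\ge 2$ there is a constant $c>0$ such that the following holds. *Graphs.* For $s\ge 2$ take a pyramid with levels $i=1,\dots,s$, level $i$ having the cells $(i,j)$, $1\le j\le s+1-i$, with edges $(i,j)\to(i+1,j)$ and $(i,j+1)\to(i+1,j)$. Add a path through all cells of each level, from left to right on odd levels and from right to left on even levels. Replace every cell with three predecessors by a pyramid of height 3 whose apex is the cell and whose three bottom nodes have one of the three predecessors each. For $2\le i\le s$ choose any cell $r_i$ of level $i$ (the root of a subpyramid of height $i$). Add a path $v_1\to\dots\to v_{c_1s}$ with the edges $r_s\to v_1$ and $r_i\to v_k$ whenever $k\equiv i-1 \pmod{s-1}$, and a path $w_1\to\dots\to w_{s-1}$ with the edges $v_{c_1s}\to w_1$ and $r_i\to w_{i-1}$. Let $Y=\{r_2,\dots,r_s,v_{c_1s},w_1,\dots,w_{s-1}\}$. The layered graph $G'$ is obtained by adding $s-1$ further copies of $Y$: an edge inside $Y$ is copied in each copy, and an edge from a node $u\notin Y$ to $y\in Y$ also yields an edge from $u$ to each copy of $y$. Its sinks are the $s$ copies of $w_{s-1}$. For each security parameter $\kappa\in\mathbb N$ fix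 $s=s(\kappa)\ge2$, polynomially bounded in $\kappa$, and a choice of the $r_i$, and let $n=n(\kappa)$ be the number of nodes of $G'$. *Hash functions.* Let $q'=q'(\kappa)$ and $\ell=\lfloor\kappa/q'\rfloor$. A *word* has $\ell$ bits. Let $\mathcal O$ be a uniformly random oracle with $\kappa$-bit outputs; its inputs are the strings $x\in\{0,1\}^\kappa$, the pairs $(v,\zeta')$ with $v$ a node and $\zeta'\in\{0,1\}^\kappa$, and the pairs of a node $v$ and a tuple of words indexed by the predecessors of $v$. Fix an input label $\zeta=\zeta(\kappa)\in\{0,1\}^\kappa$. The label of a node $v$ is $\mathcal O(v,\zeta)$ if $v$ is a source, and $\mathcal O(v,\text{labels of the predecessors of }v)$ otherwise, truncated to $\ell$ bits. $\mathcal H_1$ outputs the string $R^*$ of the labels of the $s$ sinks. $\mathcal H_2^{q'}$, on input $x\in\{0,1\}^\kappa$, queries $\rho_0=\mathcal O(x)$ and $\rho_1=\mathcal O(x+1\bmod 2^\kappa)$, obtains $\iota_1,\dots,\iota_{q'}$ by reducing $q'$ disjoint blocks of $\ell$ bits of $\rho_0$ modulo the number $s$ of words of $R^*$, and outputs $h_\kappa(x)=(R^*_{\iota_1}\|\dots\|R^*_{\iota_{q'}})\oplus\rho_1$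 (the concatenation being padded with zeros to $\kappa$ bits). *Adversaries.* A parallel random oracle algorithm $\mathcal A$ works in iterations. Iteration $i$ computes from the state $\sigma_{i-1}\in\{0,1\}^*$ and the random coins $\rho$ a batch of oracle queries, and from the answers a new state $\sigma_i$, values that are appended to the output register, and whether to stop; $\sigma_0$ is the input. $\mathcal A$ may depend on $\kappa$ (non-uniformly), its numbers of iterations and of oracle queries are bounded by a polynomial in $\kappa+|\sigma_0|$, and its computation is otherwise unrestricted (so every PPT algorithm is included). *Hardness.* For $L,\tau,q$ depending on $\kappa$, the family is *$(L,\tau,q)$-hard* if for every $\Delta\in\omega(\log\kappa)$ and every such $\mathcal A$ there is a negligible function $\varepsilon$ such that, for all large $\kappa$, every set $X\subseteq\{0,1\}^\kappa$ with $|X|=q$ and all static strings $R=R(\mathcal O)$ of at most $L-\Delta$ bits (which may depend arbitrarily on the oracle), the probability over $\mathcal O$ and $\rho$ that $\mathcal A$ on input $R$ outputs exactly $\{(x,h_\kappa(x)):x\in X\}$ while fewer than $\tau$ of its states $\sigma_i$ have at least $L$ bits is less than $\varepsilon(\kappa)$. *Claim.* If $\Lambda=\Lambda(\kappa)\in\Theta(\sqrt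 n)$ (in bits), $q'\in\omega(\log\Lambda)$, $\kappa/q'\in\omega(\log\kappa)$, and $\lambda\ge0$ is a real constant, then the family described by $(\mathcal H_1,\mathcal H_2^{q'})$ is $(\Lambda-\lambda,\;c\,n,\;q)$-hard with $q=\lceil\Lambda/\ell\rceil$, the number of words in $\Lambda$ bits. So an adversary that stores noticeably less than $\Lambda$ bits of static memory must use about $\Lambda$ bits of dynamic memory for $\Theta(n)$ steps. -/

import Mathlib

/-! ### Directed acyclic graphs and the layering transformation -/

/-- A finite directed acyclic graph: `E u v` means that there is an edge from `u` to `v`. -/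
structure Dag where
  V : Type
  finite : Finite V
  E : V → V → Prop
  acyclic : WellFounded E

namespace Dag

/-- A node without outgoing edges. -/
def IsSink (G : Dag) (v : G.V) : Prop := ∀ u, ¬ G.E v u

/-- The edges of the layered graph: `Sum.inl v` is the original node `v`, `Sum.inr (i, y)` is the
copy number `i + 1` of `y ∈ Y`. Edges inside `Y` are copied inside each copy; edges which enter
`Y` from outside also enter each copy. -/
inductive LayerE (G : Dag) (Y : Set G.V) (m : ℕ) : G.V ⊕ (Fin m × Y) → G.V ⊕ (Fin m × Y) → Prop
  | orig (u v : G.V) : G.E u v → LayerE G Y m (Sum.inl u) (Sum.inl v)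
  | within (i : Fin m) (u v : Y) : G.E u v → LayerE G Y m (Sum.inr (i, u)) (Sum.inr (i, v))
  | into (i : Fin m) (u : G.V) (v : Y) : u ∉ Y → G.E u v →
      LayerE G Y m (Sum.inl u) (Sum.inr (i, v))

/-- The layering transformation: add `m` further copies of the node set `Y` (which is the set
`X ∪ D` of the frontier `X` and the nodes `D` that remain to be pebbled after it). -/
def layer (G : Dag) (Y : Set G.V) (m : ℕ) : Dag where
  V := G.V ⊕ (Fin m × Y)
  finite := by
    have := G.finite
    infer_instance
  E := LayerE G Y m
  acyclic := by
    refine Subrelation.wf (r := InvImage G.E (Sum.elim id fun p => (p.2 : G.V))) ?_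
      (InvImage.wf _ G.acyclic)
    intro a b h
    cases h <;> simpa [InvImage] using ‹G.E _ _›

end Dag

/-! ### The base graph: a pyramid with level paths, followed by two paths -/

/-- Names of nodes. `cell i j` is the `j`-th node from the left in level `i` of the pyramid, levels
being counted from the base, `1 ≤ i ≤ s`, `1 ≤ j ≤ s + 1 - i`. A cell that would have three direct
predecessors is the apex of a pyramid of height `3`, whose three bottom nodes are `gad i j 0`,
`gad i j 1`, `gad i j 2`, and whose two middle nodes are `gad i j 3`, `gad i j 4`. -/
inductive PNode : Type
  | cell (i j : ℕ)
  | gad (i j : ℕ) (p : Fin 5)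
  | v (k : ℕ)
  | w (l : ℕ)

namespace PNode

/-- `cell i j` exists in the pyramid of height `s`. -/
def IsCell (s i j : ℕ) : Prop := 1 ≤ i ∧ 1 ≤ j ∧ i + j ≤ s + 1

/-- `PathPred s i j j'`: the cell `(i, j')` immediately precedes `(i, j)` on the path through
level `i`. The path runs from left to right on odd levels and from right to left on even levels, so
that the path through a level starts above the end of the path through the level below. -/
def PathPred (s i j j' : ℕ) : Prop :=
  IsCell s i j ∧ IsCell s i j' ∧ ((Odd i ∧ j = j' + 1) ∨ (Even i ∧ j' = j + 1))

/-- The cell `(i, j)` has two predecessors in the level below and one on its level path. -/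
def IsTriple (s i j : ℕ) : Prop := 2 ≤ i ∧ ∃ j', PathPred s i j j'

/-- The nodes of the graph with parameters `s` and `c₁`. -/
def Valid (s c₁ : ℕ) : PNode → Prop
  | cell i j => IsCell s i j
  | gad i j _ => IsTriple s i j
  | v k => 1 ≤ k ∧ k ≤ c₁ * s
  | w l => 1 ≤ l ∧ l + 1 ≤ s

/-- The edges of the graph, where `r i = cell i (root i)` is the chosen root of a subpyramid of
height `i`, for `2 ≤ i ≤ s`. -/
inductive Edge (s c₁ : ℕ) (root : ℕ → ℕ) : PNode → PNode → Prop
  | base (j j' : ℕ) : PathPred s 1 j j' → Edge s c₁ root (cell 1 j') (cell 1 j)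
  | left (i j : ℕ) : ¬ IsTriple s (i + 1) j → Edge s c₁ root (cell i j) (cell (i + 1) j)
  | right (i j : ℕ) : ¬ IsTriple s (i + 1) j → Edge s c₁ root (cell i (j + 1)) (cell (i + 1) j)
  | gadLeft (i j : ℕ) : Edge s c₁ root (cell i j) (gad (i + 1) j 0)
  | gadPath (i j j' : ℕ) : PathPred s i j j' → Edge s c₁ root (cell i j') (gad i j 1)
  | gadRight (i j : ℕ) : Edge s c₁ root (cell i (j + 1)) (gad (i + 1) j 2)
  | mid03 (i j : ℕ) : Edge s c₁ root (gad i j 0) (gad i j 3)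
  | mid13 (i j : ℕ) : Edge s c₁ root (gad i j 1) (gad i j 3)
  | mid14 (i j : ℕ) : Edge s c₁ root (gad i j 1) (gad i j 4)
  | mid24 (i j : ℕ) : Edge s c₁ root (gad i j 2) (gad i j 4)
  | apex3 (i j : ℕ) : Edge s c₁ root (gad i j 3) (cell i j)
  | apex4 (i j : ℕ) : Edge s c₁ root (gad i j 4) (cell i j)
  | vPath (k : ℕ) : Edge s c₁ root (v k) (v (k + 1))
  | vFirst : Edge s c₁ root (cell s (root s)) (v 1)
  | vRoot (k i : ℕ) : 2 ≤ i → i ≤ s → k % (s - 1) = (i - 1) % (s - 1) →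
      Edge s c₁ root (cell i (root i)) (v k)
  | wFirst : Edge s c₁ root (v (c₁ * s)) (w 1)
  | wPath (l : ℕ) : Edge s c₁ root (w l) (w (l + 1))
  | wRoot (i : ℕ) : 2 ≤ i → i ≤ s → Edge s c₁ root (cell i (root i)) (w (i - 1))

/-- A rank which increases along the edges between nodes of the graph. -/
def rank (s : ℕ) : PNode → ℕ ×ₗ ℕ ×ₗ ℕ ×ₗ ℕ
  | cell i j => toLex (0, toLex (i, toLex (if Odd i then j else s + 1 - j, 2)))
  | gad i j p => toLex (0, toLex (i, toLex (if Odd i then j else s + 1 - j, if p.1 < 3 then 0 else 1)))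
  | v k => toLex (1, toLex (k, toLex (0, 0)))
  | w l => toLex (2, toLex (l, toLex (0, 0)))

theorem rank_lt {s c₁ : ℕ} {root : ℕ → ℕ} {x y : PNode} (h : Edge s c₁ root x y) :
    rank s x < rank s y := by
  have key : ∀ i j j', PathPred s i j j' →
      (if Odd i then j' else s + 1 - j') < (if Odd i then j else s + 1 - j) := by
    rintro i j j' ⟨h1, h2, h3⟩
    unfold IsCell at h1 h2
    rcases h3 with ⟨ho, e⟩ | ⟨he, e⟩
    · simp only [ho, if_true]; omega
    · simp only [Nat.not_odd_iff_even.mpr he, if_false]; omega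
  cases h <;> simp [rank, Prod.Lex.toLex_lt_toLex]
  · rename_i h; simpa using key _ _ _ h
  · rename_i h; exact key _ _ _ h

theorem finite_valid (s c₁ : ℕ) : Finite {x : PNode // Valid s c₁ x} := by
  let B := s + c₁ * s + 2
  let f : (Fin B × Fin B) ⊕ (Fin B × Fin B × Fin 5) ⊕ Fin B ⊕ Fin B → PNode :=
    Sum.elim (fun p => cell p.1 p.2) (Sum.elim (fun p => gad p.1 p.2.1 p.2.2)
      (Sum.elim (fun k => v k) (fun l => w l)))
  refine ((Set.finite_range f).subset ?_).to_subtype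
  intro x hx
  have hB : B = s + c₁ * s + 2 := rfl
  cases x with
  | cell i j =>
    obtain ⟨h1, h2, h3⟩ : IsCell s i j := hx
    exact ⟨Sum.inl (⟨i, by omega⟩, ⟨j, by omega⟩), rfl⟩
  | gad i j p =>
    obtain ⟨-, j', ⟨h1, h2, h3⟩, -⟩ : IsTriple s i j := hx
    exact ⟨Sum.inr (Sum.inl (⟨i, by omega⟩, ⟨j, by omega⟩, p)), rfl⟩
  | v k =>
    obtain ⟨h1, h2⟩ : 1 ≤ k ∧ k ≤ c₁ * s := hx
    exact ⟨Sum.inr (Sum.inr (Sum.inl ⟨k, by omega⟩)), rfl⟩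
  | w l =>
    obtain ⟨h1, h2⟩ : 1 ≤ l ∧ l + 1 ≤ s := hx
    exact ⟨Sum.inr (Sum.inr (Sum.inr ⟨l, by omega⟩)), rfl⟩

end PNode

/-- The single-target graph with parameters `s` and `c₁`; its target is `w (s - 1)`. -/
def baseGraph (s c₁ : ℕ) (root : ℕ → ℕ) : Dag where
  V := {x : PNode // PNode.Valid s c₁ x}
  finite := PNode.finite_valid s c₁
  E x y := PNode.Edge s c₁ root x y
  acyclic := Subrelation.wf (fun h => PNode.rank_lt h)
    (InvImage.wf (fun x : {x : PNode // PNode.Valid s c₁ x} => PNode.rank s x) wellFounded_lt)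

/-- The set `X ∪ D`, where `X` consists of the roots `r 2, …, r s` and of the last node of the path
`v`, and `D` of all nodes of the path `w`. -/
def frontierSet (s c₁ : ℕ) (root : ℕ → ℕ) : Set (baseGraph s c₁ root).V :=
  {x | (∃ i, 2 ≤ i ∧ i ≤ s ∧ x.1 = PNode.cell i (root i)) ∨ x.1 = PNode.v (c₁ * s) ∨
    ∃ l, x.1 = PNode.w l}

/-- The layered graph with `s` targets. -/
def hardGraph (s c₁ : ℕ) (root : ℕ → ℕ) : Dag :=
  (baseGraph s c₁ root).layer (frontierSet s c₁ root) (s - 1)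

/-! ### Random oracle, labelings and the hash function -/

/-- The inputs of the random oracle: the messages `x`, and the pairs of a node and a tuple of
labels; the tuple is the input label (of `κ` bits) for a source query, and otherwise a tuple of
`ℓ`-bit labels that is indexed by the predecessors of the node. -/
inductive OracleInput (G : Dag) (κ ℓ : ℕ) : Type
  | msg (x : BitVec κ)
  | source (v : G.V) (ζ : BitVec κ)
  | inner (v : G.V) (a : {u // G.E u v} → BitVec ℓ)

theorem OracleInput.finite (G : Dag) (κ ℓ : ℕ) : Finite (OracleInput G κ ℓ) := by
  have := G.finite
  have : ∀ k, Finite (BitVec k) := fun k =>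
    Finite.of_injective (fun x : BitVec k => x.toFin) fun a b h => BitVec.eq_of_toFin_eq h
  let f : BitVec κ ⊕ (G.V × BitVec κ) ⊕ (Σ v : G.V, ({u // G.E u v} → BitVec ℓ)) →
      OracleInput G κ ℓ :=
    Sum.elim .msg (Sum.elim (fun p => .source p.1 p.2) (fun p => .inner p.1 p.2))
  refine Finite.of_surjective f ?_
  rintro (x | ⟨v, ζ⟩ | ⟨v, a⟩)
  · exact ⟨Sum.inl x, rfl⟩
  · exact ⟨Sum.inr (Sum.inl (v, ζ)), rfl⟩
  · exact ⟨Sum.inr (Sum.inr ⟨v, a⟩), rfl⟩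

open Classical in
/-- The labeling of `G` with input label `ζ`, where the oracle outputs are truncated to `ℓ` bits. -/
noncomputable def label (G : Dag) {κ ℓ : ℕ} (O : OracleInput G κ ℓ → BitVec κ) (ζ : BitVec κ) :
    G.V → BitVec ℓ :=
  G.acyclic.fix fun v ih =>
    (if ∃ u, G.E u v then O (.inner v fun u => ih u.1 u.2) else O (.source v ζ)).setWidth ℓ

open Classical in
theorem label_eq (G : Dag) {κ ℓ : ℕ} (O : OracleInput G κ ℓ → BitVec κ) (ζ : BitVec κ) (v : G.V) :
    label G O ζ v = (if ∃ u, G.E u v then O (.inner v fun u => label G O ζ u.1)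
      else O (.source v ζ)).setWidth ℓ := by
  unfold label
  rw [WellFounded.fix_eq]

/-- The graph function with `ℓ`-bit labels: the list of the labels of all sinks. -/
noncomputable def sinkLabels (G : Dag) {κ ℓ : ℕ} (O : OracleInput G κ ℓ → BitVec κ)
    (ζ : BitVec κ) : List (BitVec ℓ) :=
  haveI := G.finite
  List.ofFn fun k : Fin (Nat.card {v : G.V // G.IsSink v}) =>
    label G O ζ ((Finite.equivFin {v : G.V // G.IsSink v}).symm k).1

/-- The second algorithm. Here `len` is the length in words of the string `R`, and `seek ι` is its
`ι`-th word. The `m`-th block of `ℓ` bits of `ρ₀`, read as a number and reduced modulo `len`, is the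
sample `ι m`; the output is the concatenation of the `q'` words `seek (ι m)`, padded with zeros to
`κ` bits, plus (bitwise) the mask `ρ₁`. -/
def hashTwo (G : Dag) (κ ℓ q' : ℕ) (O : OracleInput G κ ℓ → BitVec κ) (len : ℕ)
    (seek : ℕ → BitVec ℓ) (x : BitVec κ) : BitVec κ :=
  let ρ₀ := O (.msg x)
  let ρ₁ := O (.msg (x + 1))
  let ι : ℕ → ℕ := fun m => (ρ₀.extractLsb' (m * ℓ) ℓ).toNat % len
  BitVec.ofNat κ (∑ m ∈ Finset.range q', (seek (ι m)).toNat * 2 ^ (ℓ * m)) ^^^ ρ₁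

/-- A static-memory hash function family: for every security parameter `κ`, a finite set of oracle
inputs, a word length, an oracle algorithm `H₁` that outputs a string of words, and an oracle
algorithm `H₂` that has access to the length and the words of that string. -/
structure SHF where
  Query : ℕ → Type
  finite : ∀ κ, Finite (Query κ)
  word : ℕ → ℕ
  H₁ : ∀ κ, (Query κ → BitVec κ) → List (BitVec (word κ))
  H₂ : ∀ κ, (Query κ → BitVec κ) → ℕ → (ℕ → BitVec (word κ)) → BitVec κ → BitVec κ

/-- The hash function `h_κ` for the oracle `O`. -/
def SHF.hash (H : SHF) (κ : ℕ) (O : H.Query κ → BitVec κ) (x : BitVec κ) : BitVec κ :=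
  H.H₂ κ O (H.H₁ κ O).length (fun ι => (H.H₁ κ O).getD ι 0) x

/-- The family built from the graphs `hardGraph (s κ) c₁ (root κ)`, the input labels `ζ κ`, with
`q' κ` samples and labels (words) of `κ / q' κ` bits. -/
noncomputable def graphSHF (c₁ : ℕ) (s : ℕ → ℕ) (root : ℕ → ℕ → ℕ) (ζ : ∀ κ, BitVec κ)
    (q' : ℕ → ℕ) : SHF where
  Query κ := OracleInput (hardGraph (s κ) c₁ (root κ)) κ (κ / q' κ)
  finite _ := OracleInput.finite _ _ _
  word κ := κ / q' κ
  H₁ κ O := sinkLabels (hardGraph (s κ) c₁ (root κ)) O (ζ κ)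
  H₂ κ := hashTwo (hardGraph (s κ) c₁ (root κ)) κ (κ / q' κ) (q' κ)

/-! ### Algorithms in the parallel random oracle model -/

/-- A probabilistic algorithm with parallel access to an oracle `Query → BitVec κ`. In iteration `i`
it computes, from the state passed on by the preceding iteration and from its coins, a batch of
queries; from the answers it computes the state that it passes on, the values which it appends to
the output register, and whether it terminates. -/
structure PromAlgorithm (Query : Type) (κ : ℕ) (Out : Type) where
  coins : ℕ
  batch : ℕ → List Bool → (Fin coins → Bool) → List Query
  step : ℕ → List Bool → (Fin coins → Bool) → List (BitVec κ) → List Bool × List Out × Bool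

/-- The state, the output register, whether the computation has ended, and the number of oracle
queries made so far. -/
structure PromConfig (Out : Type) where
  state : List Bool
  out : List Out
  halted : Bool
  queries : ℕ

namespace PromAlgorithm

variable {Query Out : Type} {κ : ℕ}

/-- The configuration after iteration `i`, on input `x`, with coins `ρ` and oracle `O`; it does not
change after termination. -/
def run (A : PromAlgorithm Query κ Out) (O : Query → BitVec κ) (x : List Bool)
    (ρ : Fin A.coins → Bool) : ℕ → PromConfig Out
  | 0 => ⟨x, [], false, 0⟩
  | i + 1 =>
    let c := run A O x ρ i
    if c.halted then c
    else
      let qs := A.batch (i + 1) c.state ρ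
      let r := A.step (i + 1) c.state ρ (qs.map O)
      ⟨r.1, c.out ++ r.2.1, r.2.2, c.queries + qs.length⟩

/-- The `L`-sustained memory complexity: the number of iterations `i` (up to termination, and
including the input state `i = 0`) whose state has at least `L` bits. -/
noncomputable def sustainedMem (A : PromAlgorithm Query κ Out) (O : Query → BitVec κ)
    (x : List Bool) (ρ : Fin A.coins → Bool) (L : ℝ) : ℕ :=
  Set.ncard {i : ℕ | (∀ j < i, (A.run O x ρ j).halted = false) ∧
    L ≤ ((A.run O x ρ i).state.length : ℝ)}

/-- The algorithm terminates, and its output register then holds exactly the elements of `S`. -/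
def Outputs (A : PromAlgorithm Query κ Out) (O : Query → BitVec κ) (x : List Bool)
    (ρ : Fin A.coins → Bool) (S : Set Out) : Prop :=
  ∃ t, (A.run O x ρ t).halted = true ∧ {y | y ∈ (A.run O x ρ t).out} = S

end PromAlgorithm

/-- The numbers of iterations and of oracle queries are polynomially bounded in the length of the
input `(1^κ, x)`. -/
def PolyBounded {Query Out : ℕ → Type} (A : ∀ κ, PromAlgorithm (Query κ) κ (Out κ)) : Prop :=
  ∃ p : Polynomial ℕ, ∀ κ (O : Query κ → BitVec κ) (x : List Bool) (ρ : Fin (A κ).coins → Bool),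
    ((A κ).run O x ρ (p.eval (κ + x.length))).halted = true ∧
    ((A κ).run O x ρ (p.eval (κ + x.length))).queries ≤ p.eval (κ + x.length)

/-- The probability of an event under the uniform distribution on a finite set. -/
noncomputable def unifProb {Ω : Type} (E : Set Ω) : ℝ := (Nat.card E : ℝ) / Nat.card Ω

/-- `(Λ, τ, q)`-hardness. For every `Δ ∈ ω(log κ)` and every polynomially bounded algorithm `A`
there is a negligible `ε` such that for all large `κ`, all sets `X` of `q κ` inputs and all static
strings `R` of at most `Λ κ - Δ κ` bits, which may depend on the oracle: the probability that `A`,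
started on `R`, outputs the set of all pairs `(x, h x)`, `x ∈ X`, while fewer than `τ κ` of its
states have at least `Λ κ` bits, is less than `ε κ`. -/
def SHF.IsHard (H : SHF) (Λ τ : ℕ → ℝ) (q : ℕ → ℕ) : Prop :=
  ∀ Δ : ℕ → ℝ, Filter.Tendsto (fun κ => Δ κ / Real.log κ) Filter.atTop Filter.atTop →
  ∀ A : ∀ κ, PromAlgorithm (H.Query κ) κ (BitVec κ × BitVec κ), PolyBounded A →
  ∃ ε : ℕ → ℝ, Asymptotics.SuperpolynomialDecay Filter.atTop (fun κ : ℕ => (κ : ℝ)) ε ∧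
  ∀ᶠ κ in Filter.atTop, ∀ X : Finset (BitVec κ), X.card = q κ →
  ∀ R : (H.Query κ → BitVec κ) → List Bool, (∀ O, ((R O).length : ℝ) ≤ Λ κ - Δ κ) →
    unifProb {ω : (H.Query κ → BitVec κ) × (Fin (A κ).coins → Bool) |
      (A κ).Outputs ω.1 (R ω.1) ω.2 {y | ∃ x ∈ X, y = (x, H.hash κ ω.1 x)} ∧
      ((A κ).sustainedMem ω.1 (R ω.1) ω.2 (Λ κ) : ℝ) < τ κ} < ε κ

/-! Call an iteration small if its state is below the memory threshold. A node is needed at a time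
if its label is used afterwards before being recomputed (`Dag.Needed`); such a label can be read off
from the run resumed from the state at that time. A random oracle is incompressible, so except with
negligible probability a state of at most `m` bits leaves fewer than `k` needed nodes as soon as `2
* m ≤ k * ℓ` (`Dag.card_mul_two_pow_le`, `Dag.card_predictable_mul_le`). At time 0 the count
includes targets whose labels enter the output without ever being computed. Needed nodes thus play
the role of pebbles.

Pebbling: let `h = s / 8`, and suppose that fewer than `h` nodes are needed at every small time and
that large states persist only for short periods. Descents that avoid a fixed cell on each level are
pairwise disjoint, so few pebbles leave some root `r_i`, `i ≥ 7h`, with a pebble-free climb from the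
base. The descents that branch off this climb are disjoint as well and diverge downwards; between
two free ones at distance `h`, the alternating level paths force more than `2 * h * h` steps
(`IsDepth.zigzag`, `IsDepth.deep`). Hence the upper part of the climb is not reached before the next
small time, when some descent from it is free again (`IsOpen.next`), and `r_i` is never computed.
Every target depends on `r_i` through the path `w` of its own copy, so computing it requires a node
of that copy to be needed at time 0 (`HardGraph.exists_needed_of_comp_sink`).

Consequently each sampled target yields its own label predictable from the static string, whereas
the samples very probably hit many distinct targets (`card_few_samples_mul_le`). An adversary that
succeeds with few large states must therefore compress the oracle or meet an unlikely set of samples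
(`predictable_or_few_samples`). Here `2 * h * h` is of order `n`. -/

namespace PNode

/-! ### Descents in the pyramid -/

/-- The column, `e` levels below level `j`, of the path which descends from the cell `(j, a j)` and
avoids the cells `(m, a m)` of the lower levels. -/
def descentAux (a : ℕ → ℕ) (j : ℕ) : ℕ → ℕ
  | 0 => a j
  | e + 1 => if descentAux a j e < a (j - (e + 1)) then descentAux a j e else descentAux a j e + 1

/-- The column in level `m ≤ j` of the path which descends from the cell `(j, a j)` and avoids the
cells `(m, a m)`, `m < j`. -/
def descent (a : ℕ → ℕ) (j m : ℕ) : ℕ := descentAux a j (j - m)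

theorem descent_self (a : ℕ → ℕ) (j : ℕ) : descent a j j = a j := by
  simp [descent, descentAux]

theorem descent_of_lt (a : ℕ → ℕ) {j m : ℕ} (h : m < j) :
    descent a j m =
      if descent a j (m + 1) < a m then descent a j (m + 1) else descent a j (m + 1) + 1 := by
  unfold descent
  obtain ⟨e, rfl⟩ : ∃ e, j = m + (e + 1) := ⟨j - m - 1, by omega⟩
  rw [show m + (e + 1) - m = e + 1 by omega, show m + (e + 1) - (m + 1) = e by omega]
  simp [descentAux]

theorem descent_step (a : ℕ → ℕ) {j m : ℕ} (h : m < j) :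
    descent a j m = descent a j (m + 1) ∨ descent a j m = descent a j (m + 1) + 1 := by
  rw [descent_of_lt a h]; split_ifs <;> simp

theorem descent_ne (a : ℕ → ℕ) {j m : ℕ} (h : m < j) : descent a j m ≠ a m := by
  rw [descent_of_lt a h]; split_ifs <;> omega

/-- The distance between two descents does not decrease on the way down. -/
theorem descent_gap (a : ℕ → ℕ) {j j' n m : ℕ} (hj : n ≤ j) (hj' : n ≤ j') (hm : m ≤ n)
    (h : descent a j n ≤ descent a j' n) :
    descent a j m + descent a j' n ≤ descent a j' m + descent a j n := by
  induction hm using Nat.decreasingInduction with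
  | self => omega
  | of_succ k hk ih =>
    -- The order of the two columns persists, so whenever the left descent shifts, the right one
    -- shifts too.
    rw [descent_of_lt a (show k < j by omega), descent_of_lt a (show k < j' by omega)]
    split_ifs <;> omega

/-- On level `j` the lower descent starts at the cell `(j, a j)`, which the other one avoids.
Further down, the shift is monotone in the column, so distinct columns stay distinct. -/
theorem descent_ne_descent (a : ℕ → ℕ) {j j' m : ℕ} (hj : j < j') (hm : m ≤ j) :
    descent a j m ≠ descent a j' m := by
  induction hm using Nat.decreasingInduction with
  | self => rw [descent_self]; exact (descent_ne a hj).symm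
  | of_succ k hk ih =>
    rw [descent_of_lt a (show k < j by omega), descent_of_lt a (show k < j' by omega)]
    split_ifs <;> omega

/-- At most `#B` descents meet a set `B` of cells. -/
theorem card_descent_meets (a : ℕ → ℕ) (B : Finset (ℕ × ℕ)) (J : Finset ℕ) :
    (J.filter fun j => ∃ m, m ≤ j ∧ (m, descent a j m) ∈ B).card ≤ B.card := by
  classical
  have hex : ∀ j ∈ J.filter (fun j => ∃ m, m ≤ j ∧ (m, descent a j m) ∈ B),
      ∃ m, m ≤ j ∧ (m, descent a j m) ∈ B := fun j hj => (Finset.mem_filter.mp hj).2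
  choose! m hm hB using hex
  refine Finset.card_le_card_of_injOn (fun j => (m j, descent a j (m j))) (fun j hj => hB j hj) ?_
  intro j hj j' hj' h
  simp only [Prod.mk.injEq] at h
  by_contra hne
  have h1 := hm j hj
  have h2 := hm j' hj'
  rcases lt_or_gt_of_ne hne with hlt | hlt
  · exact descent_ne_descent a hlt h1 (by rw [h.2, ← h.1])
  · exact descent_ne_descent a hlt h2 (by rw [← h.2, h.1])

/-! ### Climbs, open cells and depth -/

/-- `a` describes a path upwards to the cell `(I, a I)`, one cell per level. -/
def IsClimb (s I : ℕ) (a : ℕ → ℕ) : Prop :=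
  IsCell s I (a I) ∧ ∀ m, 1 ≤ m → m < I → a m = a (m + 1) ∨ a m = a (m + 1) + 1

theorem IsClimb.isCell {s I : ℕ} {a : ℕ → ℕ} (h : IsClimb s I a) {m : ℕ} (h1 : 1 ≤ m)
    (hm : m ≤ I) : IsCell s m (a m) := by
  induction hm using Nat.decreasingInduction with
  | self => exact h.1
  | of_succ k hk ih =>
    obtain ⟨-, h2, h3⟩ := ih (by omega)
    have := h.2 k h1 hk
    exact ⟨h1, by omega, by omega⟩

theorem isClimb_descent {s j : ℕ} {a : ℕ → ℕ} (h : IsCell s j (a j)) :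
    IsClimb s j (descent a j) :=
  ⟨by rwa [descent_self], fun _ _ hm => descent_step a hm⟩

/-- The nodes used by the climb `a` in level `m`. -/
def Used (a : ℕ → ℕ) (m : ℕ) (x : PNode) : Prop :=
  x = cell m (a m) ∨ (a (m - 1) = a m ∧ (x = gad m (a m) 0 ∨ x = gad m (a m) 3)) ∨
    (a (m - 1) = a m + 1 ∧ (x = gad m (a m) 2 ∨ x = gad m (a m) 4))

/-- The cell to which a node of the pyramid belongs. -/
def block : PNode → ℕ × ℕ
  | cell i j => (i, j)
  | gad i j _ => (i, j)
  | v _ => (0, 0)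
  | w _ => (0, 0)

theorem Used.block_eq {a : ℕ → ℕ} {m : ℕ} {x : PNode} (h : Used a m x) : block x = (m, a m) := by
  rcases h with rfl | ⟨-, rfl | rfl⟩ | ⟨-, rfl | rfl⟩ <;> rfl

theorem Used.congr {a b : ℕ → ℕ} {m : ℕ} (h0 : a (m - 1) = b (m - 1)) (h1 : a m = b m)
    {x : PNode} (h : Used a m x) : Used b m x := by
  unfold Used at *; rwa [← h0, ← h1]

/-- The cell `(I, r)` can be reached from the base by a climb that avoids `S`. -/
def IsOpen (s : ℕ) (S : Finset PNode) (I r : ℕ) : Prop :=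
  ∃ a, IsClimb s I a ∧ a I = r ∧ ∀ m, 1 ≤ m → m ≤ I → ∀ x, Used a m x → x ∉ S

/-- The predicate `D g x` says that pebbling `x` takes more than `g` steps if the nodes in `S` are
already pebbled. These are the closure properties that are used. -/
structure IsDepth (s c₁ : ℕ) (root : ℕ → ℕ) (S : Finset PNode) (D : ℕ → PNode → Prop) : Prop where
  zero : ∀ x, D 0 x
  anti : ∀ g x, D (g + 1) x → D g x
  invalid : ∀ g x, ¬ Valid s c₁ x → D g x
  step : ∀ g x y, Valid s c₁ x → Edge s c₁ root x y → x ∉ S → D g x → D (g + 1) y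

namespace IsDepth

variable {s c₁ : ℕ} {root : ℕ → ℕ} {S : Finset PNode} {D : ℕ → PNode → Prop}

theorem mono (h : IsDepth s c₁ root S D) {g g' : ℕ} {x : PNode} (hg : g ≤ g') (hx : D g' x) :
    D g x := by
  induction hg using Nat.decreasingInduction with
  | self => exact hx
  | of_succ k hk ih => exact h.anti _ _ ih

theorem step' (h : IsDepth s c₁ root S D) {g : ℕ} {x y : PNode} (hv : Valid s c₁ x)
    (he : Edge s c₁ root x y) (hx : x ∉ S) (hD : D g x) : D g y :=
  h.anti _ _ (h.step _ _ _ hv he hx hD)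

/-- One step upwards along a climb. -/
theorem used_succ (h : IsDepth s c₁ root S D) {I g : ℕ} {a : ℕ → ℕ} (ha : IsClimb s I a) {m : ℕ}
    (h1 : 1 ≤ m) (hm : m < I) (hS : ∀ x, Used a (m + 1) x → x ∉ S) (hc : cell m (a m) ∉ S)
    (hD : D g (cell m (a m))) {x : PNode} (hx : Used a (m + 1) x) : D g x := by
  have hcell : Valid s c₁ (cell m (a m)) := ha.isCell h1 hm.le
  unfold Used at hS hx
  simp only [Nat.add_sub_cancel] at hS hx
  have key : ∀ p q : Fin 5, Edge s c₁ root (cell m (a m)) (gad (m + 1) (a (m + 1)) p) →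
      Edge s c₁ root (gad (m + 1) (a (m + 1)) p) (gad (m + 1) (a (m + 1)) q) →
      Edge s c₁ root (gad (m + 1) (a (m + 1)) q) (cell (m + 1) (a (m + 1))) →
      (¬ IsTriple s (m + 1) (a (m + 1)) →
        Edge s c₁ root (cell m (a m)) (cell (m + 1) (a (m + 1)))) →
      gad (m + 1) (a (m + 1)) p ∉ S → gad (m + 1) (a (m + 1)) q ∉ S →
      D g (gad (m + 1) (a (m + 1)) p) ∧ D g (gad (m + 1) (a (m + 1)) q) ∧
        D g (cell (m + 1) (a (m + 1))) := by
    intro p q e1 e2 e3 e4 hp hq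
    have d1 := h.step' hcell e1 hc hD
    by_cases ht : IsTriple s (m + 1) (a (m + 1))
    · have d2 := h.step' (show Valid s c₁ (gad _ _ p) from ht) e2 hp d1
      exact ⟨d1, d2, h.step' (show Valid s c₁ (gad _ _ q) from ht) e3 hq d2⟩
    -- Without a gadget its names denote no nodes and are deep by convention; the cell is then
    -- reached by a direct edge.
    · exact ⟨d1, h.invalid _ _ ht, h.step' hcell (e4 ht) hc hD⟩
  rcases ha.2 m h1 hm with e | e
  · obtain ⟨d1, d2, d3⟩ := key 0 3 (by rw [e]; exact .gadLeft _ _) (.mid03 _ _) (.apex3 _ _)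
      (fun ht => by rw [e]; exact .left _ _ ht) (hS _ (by simp [e])) (hS _ (by simp [e]))
    rcases hx with rfl | ⟨-, rfl | rfl⟩ | ⟨e', -⟩
    exacts [d3, d1, d2, by omega]
  · obtain ⟨d1, d2, d3⟩ := key 2 4 (by rw [e]; exact .gadRight _ _) (.mid24 _ _) (.apex4 _ _)
      (fun ht => by rw [e]; exact .right _ _ ht) (hS _ (by simp [e])) (hS _ (by simp [e]))
    rcases hx with rfl | ⟨e', -⟩ | ⟨-, rfl | rfl⟩
    exacts [d3, by omega, d1, d2]

/-- Along a climb that avoids `S`, the depth does not decrease. -/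
theorem used_of_le (h : IsDepth s c₁ root S D) {I g : ℕ} {a : ℕ → ℕ} (ha : IsClimb s I a) {m n : ℕ}
    (h1 : 1 ≤ m) (hmn : m ≤ n) (hn : n ≤ I)
    (hS : ∀ k, m ≤ k → k ≤ n → ∀ x, Used a k x → x ∉ S) (hD : D g (cell m (a m))) :
    D g (cell n (a n)) ∧ (m < n → ∀ x, Used a n x → D g x) := by
  induction n, hmn using Nat.le_induction with
  | base => exact ⟨hD, fun h => absurd h (lt_irrefl _)⟩
  | succ n hmn ih =>
    obtain ⟨ih, -⟩ := ih (by omega) fun k hk hkn => hS k hk (by omega)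
    have : ∀ x, Used a (n + 1) x → D g x := fun x hx =>
      h.used_succ ha (by omega) (by omega) (hS _ (by omega) le_rfl)
        (hS n hmn (by omega) _ (Or.inl rfl)) ih hx
    exact ⟨this _ (Or.inl rfl), fun _ => this⟩

/-- One step along the path through a level. -/
theorem path_step (h : IsDepth s c₁ root S D) {i j j' g : ℕ} (hp : PathPred s i j j')
    (hS : ∀ x ∈ S, (block x).1 ≠ i) (hD : D g (cell i j')) : D (g + 1) (cell i j) := by
  have hn : ∀ x, (block x).1 = i → x ∉ S := fun x hx hxS => hS x hxS hx
  by_cases hi : i = 1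
  · subst hi
    exact h.step _ (cell 1 j') _ hp.2.1 (.base _ _ hp) (hn _ rfl) hD
  -- The route through the gadget nodes 1 and 3 gains three steps, of which only one is kept.
  · have ht : IsTriple s i j := ⟨by have := hp.1.1; omega, j', hp⟩
    have d1 := h.step _ (cell i j') _ hp.2.1 (.gadPath _ _ _ hp) (hn _ rfl) hD
    have d2 := h.step _ (gad i j 1) _ ht (.mid13 _ _) (hn _ rfl) d1
    exact h.mono (by omega) (h.step _ (gad i j 3) _ ht (.apex3 _ _) (hn _ rfl) d2)

/-- A walk of length `d` along the path through a level. -/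
theorem walk (h : IsDepth s c₁ root S D) {i l r g : ℕ} (hlr : l ≤ r) (hl : IsCell s i l)
    (hr : IsCell s i r) (hS : ∀ x ∈ S, (block x).1 ≠ i) :
    (Odd i → D g (cell i l) → D (g + (r - l)) (cell i r)) ∧
      (Even i → D g (cell i r) → D (g + (r - l)) (cell i l)) := by
  obtain ⟨d, rfl⟩ := Nat.exists_eq_add_of_le hlr
  clear hlr
  rw [Nat.add_sub_cancel_left]
  constructor
  · intro ho hD
    induction d with
    | zero => exact hD
    | succ d ih =>
      have hc : IsCell s i (l + d) := by unfold IsCell at *; omega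
      exact h.path_step ⟨hr, hc, Or.inl ⟨ho, rfl⟩⟩ hS (ih hc)
  · intro he hD
    suffices ∀ e ≤ d, D (g + e) (cell i (l + d - e)) by simpa using this d le_rfl
    intro e hed
    induction e with
    | zero => exact hD
    | succ e ih =>
      refine h.path_step (j' := l + d - e) ⟨?_, ?_, Or.inr ⟨he, by omega⟩⟩ hS (ih (by omega)) <;>
      · unfold IsCell at *; omega

end IsDepth

/-- The levels up to `2 * A`, in pairs, that contain no element of `S`. -/
theorem card_clean_pairs (S : Finset PNode) (A : ℕ) :
    A ≤ ((Finset.range A).filter fun p =>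
      ∀ x ∈ S, (block x).1 ≠ 2 * p + 1 ∧ (block x).1 ≠ 2 * p + 2).card + S.card := by
  classical
  have h := Finset.card_filter_add_card_filter_not (s := Finset.range A) (fun p =>
      ∀ x ∈ S, (block x).1 ≠ 2 * p + 1 ∧ (block x).1 ≠ 2 * p + 2)
  rw [Finset.card_range] at h
  -- An element of `S` spoils only the one pair of levels that contains it.
  have : ((Finset.range A).filter fun p =>
      ¬ ∀ x ∈ S, (block x).1 ≠ 2 * p + 1 ∧ (block x).1 ≠ 2 * p + 2) ⊆
      S.image fun x => ((block x).1 - 1) / 2 := by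
    intro p hp
    simp only [Finset.mem_filter, Finset.mem_range, not_forall] at hp
    obtain ⟨-, x, hx, hne⟩ := hp
    refine Finset.mem_image.mpr ⟨x, hx, ?_⟩
    omega
  have := (Finset.card_le_card this).trans Finset.card_image_le
  omega

/-- Since descents are disjoint, each pebble blocks at most one of them; `block` charges a pebble on
a gadget to its cell. -/
theorem exists_free_descents (S : Finset PNode) (a : ℕ → ℕ) (J : Finset ℕ) :
    ∃ U ⊆ J, J.card ≤ U.card + S.card ∧
      ∀ j ∈ U, ∀ m ≤ j, ∀ x, block x = (m, descent a j m) → x ∉ S := by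
  classical
  refine ⟨J.filter fun j => ∀ m ≤ j, ∀ x, block x = (m, descent a j m) → x ∉ S,
    Finset.filter_subset _ _, ?_, fun j hj => (Finset.mem_filter.mp hj).2⟩
  have h := Finset.card_filter_add_card_filter_not (s := J) (fun j =>
      ∀ m ≤ j, ∀ x, block x = (m, descent a j m) → x ∉ S)
  have h2 : (J.filter fun j => ¬ ∀ m ≤ j, ∀ x, block x = (m, descent a j m) → x ∉ S) ⊆
      J.filter fun j => ∃ m, m ≤ j ∧ (m, descent a j m) ∈ S.image block := by
    intro j hj
    simp only [Finset.mem_filter, not_forall, not_not] at hj ⊢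
    obtain ⟨hj, m, hm, x, hx, hxS⟩ := hj
    exact ⟨hj, m, hm, hx ▸ Finset.mem_image_of_mem _ hxS⟩
  have := (Finset.card_le_card h2).trans (card_descent_meets a (S.image block) J)
  have := this.trans Finset.card_image_le
  omega

theorem exists_free_descent (S : Finset PNode) (a : ℕ → ℕ) (J : Finset ℕ) (h : S.card < J.card) :
    ∃ j ∈ J, ∀ m ≤ j, ∀ x, block x = (m, descent a j m) → x ∉ S := by
  obtain ⟨U, hUJ, hU, hfree⟩ := exists_free_descents S a J
  obtain ⟨j, hj⟩ := Finset.card_pos.mp (show 0 < U.card by omega)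
  exact ⟨j, hUJ hj, hfree j hj⟩

/-- The zigzag between two free descents. -/
theorem IsDepth.zigzag {s c₁ : ℕ} {root : ℕ → ℕ} {S : Finset PNode} {D : ℕ → PNode → Prop}
    (h : IsDepth s c₁ root S D) {d e : ℕ → ℕ} {I I' A g : ℕ} (hd : IsClimb s I d)
    (he : IsClimb s I' e) (hI : 2 * A < I) (hI' : 2 * A < I')
    (hdS : ∀ m ≤ I, ∀ x, block x = (m, d m) → x ∉ S)
    (heS : ∀ m ≤ I', ∀ x, block x = (m, e m) → x ∉ S)
    (hg : ∀ m ≤ 2 * A, d m + g ≤ e m) :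
    D (((Finset.range A).filter fun p =>
      ∀ x ∈ S, (block x).1 ≠ 2 * p + 1 ∧ (block x).1 ≠ 2 * p + 2).card * (2 * g))
      (cell (2 * A + 1) (d (2 * A + 1))) := by
  have hdS' : ∀ m ≤ I, ∀ x, Used d m x → x ∉ S := fun m hm x hx => hdS m hm x hx.block_eq
  have heS' : ∀ m ≤ I', ∀ x, Used e m x → x ∉ S := fun m hm x hx => heS m hm x hx.block_eq
  induction A with
  | zero => simpa using h.zero _
  | succ A ih =>
    have ih := ih (by omega) (by omega) fun m hm => hg m (by omega)
    rw [Finset.range_add_one, Finset.filter_insert]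
    split_ifs with hcl
    · rw [Finset.card_insert_of_notMem (by simp), add_mul, one_mul]
      set n := ((Finset.range A).filter fun p =>
        ∀ x ∈ S, (block x).1 ≠ 2 * p + 1 ∧ (block x).1 ≠ 2 * p + 2).card * (2 * g)
      have g1 := hg (2 * A + 1) (by omega)
      have g2 := hg (2 * A + 2) (by omega)
      -- The dependency chain runs right along the odd level from `d` to `e`, one level up `e`, back
      -- along the even level to `d`, and up `d`. Both walks have length at least `g`.
      have w1 := (h.walk (g := n) (by omega) (hd.isCell (m := 2 * A + 1) (by omega) (by omega))
        (he.isCell (by omega) (by omega)) fun x hx => (hcl x hx).1).1 ⟨A, rfl⟩ ih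
      have u1 := (h.used_of_le he (m := 2 * A + 1) (n := 2 * A + 2) (by omega) (by omega)
        (by omega) (fun k _ hk => heS' k (by omega)) w1).1
      have w2 := (h.walk (by omega) (hd.isCell (m := 2 * A + 2) (by omega) (by omega))
        (he.isCell (by omega) (by omega)) fun x hx => (hcl x hx).2).2 ⟨A + 1, by ring⟩ u1
      have u2 := (h.used_of_le hd (m := 2 * A + 2) (n := 2 * A + 3) (by omega) (by omega)
        (by omega) (fun k _ hk => hdS' k (by omega)) w2).1
      exact h.mono (by omega) u2
    -- A pair of levels with a pebble is crossed along `d` without gain.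
    · exact (h.used_of_le hd (m := 2 * A + 1) (n := 2 * A + 3) (by omega) (by omega)
        (by omega) (fun k _ hk => hdS' k (by omega)) ih).1

/-- The upper part of an open climb is deep. -/
theorem IsDepth.deep {s c₁ : ℕ} {root : ℕ → ℕ} {S : Finset PNode} {D : ℕ → PNode → Prop}
    (h : IsDepth s c₁ root S D) {k I : ℕ} {a : ℕ → ℕ} (hS : S.card < k) (ha : IsClimb s I a)
    (hI : 6 * k < I) (haS : ∀ m, 1 ≤ m → m ≤ I → ∀ x, Used a m x → x ∉ S) :
    ∀ m, 6 * k < m → m ≤ I → ∀ x, Used a m x → D (2 * k * k) x := by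
  -- Of the `2 * k` descents that branch off the climb at these levels, more than `k` are free.
  obtain ⟨U, hUJ, hUc, hfree⟩ := exists_free_descents S a (Finset.Ioc (4 * k) (6 * k))
  rw [Nat.card_Ioc] at hUc
  have hmem : ∀ j ∈ U, 4 * k < j ∧ j ≤ 6 * k ∧
      ∀ m ≤ j, ∀ x, block x = (m, descent a j m) → x ∉ S := fun j hj =>
    have h1 := Finset.mem_Ioc.mp (hUJ hj)
    ⟨h1.1, h1.2, hfree j hj⟩
  have hinj : Set.InjOn (fun j => descent a j (4 * k)) U := by
    intro j hj j' hj' hjj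
    by_contra hne
    rcases lt_or_gt_of_ne hne with hlt | hlt
    · exact descent_ne_descent a hlt (hmem j hj).1.le hjj
    · exact descent_ne_descent a hlt (hmem j' hj').1.le hjj.symm
  have hne : U.Nonempty := Finset.card_pos.mp (by omega)
  obtain ⟨l, hl, hlmin⟩ := U.exists_min_image (fun j => descent a j (4 * k)) hne
  obtain ⟨r, hr, hrmax⟩ := U.exists_max_image (fun j => descent a j (4 * k)) hne
  -- More than `k` distinct columns span a distance of at least `k`, and `descent_gap` preserves it
  -- on all lower levels.
  have hgap : descent a l (4 * k) + k ≤ descent a r (4 * k) := by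
    have h1 : U.image (fun j => descent a j (4 * k)) ⊆
        Finset.Icc (descent a l (4 * k)) (descent a r (4 * k)) := by
      intro y hy
      obtain ⟨j, hj, rfl⟩ := Finset.mem_image.mp hy
      exact Finset.mem_Icc.mpr ⟨hlmin j hj, hrmax j hj⟩
    have h2 := Finset.card_le_card h1
    rw [Finset.card_image_of_injOn hinj, Nat.card_Icc] at h2
    omega
  obtain ⟨l1, l2, l3⟩ := hmem l hl
  obtain ⟨r1, r2, r3⟩ := hmem r hr
  have hlc := isClimb_descent (ha.isCell (show 1 ≤ l by omega) (by omega))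
  have hrc := isClimb_descent (ha.isCell (show 1 ≤ r by omega) (by omega))
  have hz := h.zigzag (A := 2 * k) (g := k) hlc hrc (by omega) (by omega) l3 r3 fun m hm => by
    have := descent_gap a (n := 4 * k) (m := m) l1.le r1.le (by omega) (by omega)
    omega
  -- Fewer than `k` of the `2 * k` pairs contain a pebble, so at least `k` pairs gain `2 * k` each.
  have hcount := card_clean_pairs S (2 * k)
  have hz := h.mono (g := 2 * k * k) (by
    calc 2 * k * k = k * (2 * k) := by ring
      _ ≤ _ := Nat.mul_le_mul_right _ (by omega)) hz
  -- The depth travels up the free left descent to its start `(l, a l)`, and from there along the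
  -- open climb.
  have hl' := (h.used_of_le hlc (m := 2 * (2 * k) + 1) (n := l) (by omega) (by omega) le_rfl
    (fun m _ hm x hx => l3 m hm x hx.block_eq) hz).1
  rw [descent_self] at hl'
  intro m hm hmI
  exact (h.used_of_le ha (m := l) (n := m) (by omega) (by omega) hmI
    (fun i hi hi' => haS i (by omega) (by omega)) hl').2 (by omega)

theorem IsOpen.deep {s c₁ : ℕ} {root : ℕ → ℕ} {S : Finset PNode} {D : ℕ → PNode → Prop}
    (h : IsDepth s c₁ root S D) {k I r : ℕ} (hS : S.card < k) (hI : 6 * k < I)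
    (ho : IsOpen s S I r) : D (2 * k * k) (cell I r) := by
  obtain ⟨a, ha, rfl, haS⟩ := ho
  exact h.deep hS ha hI haS I hI le_rfl _ (Or.inl rfl)

/-- An open cell stays open if only nodes of small depth are pebbled. -/
theorem IsOpen.next {s c₁ : ℕ} {root : ℕ → ℕ} {S S' : Finset PNode} {D : ℕ → PNode → Prop}
    (h : IsDepth s c₁ root S D) {k I r : ℕ} (hS : S.card < k) (hS' : S'.card < k)
    (hI : 7 * k ≤ I) (hD : ∀ x ∈ S', x ∉ S → ¬ D (2 * k * k) x) (ho : IsOpen s S I r) :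
    IsOpen s S' I r := by
  obtain ⟨a, ha, rfl, haS⟩ := ho
  have hdeep := h.deep hS ha (by omega) haS
  -- Since `7 * k ≤ I`, there are at least `k` starting levels above `6 * k`, more than elements of
  -- `S'`.
  obtain ⟨j, hj, hjS⟩ := exists_free_descent S' a (Finset.Ioc (6 * k) I) (by
    rw [Nat.card_Ioc]; omega)
  rw [Finset.mem_Ioc] at hj
  have hjc := isClimb_descent (ha.isCell (show 1 ≤ j by omega) (by omega))
  -- The new climb follows the descent free of `S'` up to level `j` and the old climb above it. The
  -- old part is deep and avoids `S`, so no node on it can be newly pebbled.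
  refine ⟨fun m => if m ≤ j then descent a j m else a m, ⟨?_, ?_⟩, ?_, ?_⟩
  · dsimp only
    split_ifs with hIj
    · obtain rfl : I = j := by omega
      exact hjc.1
    · exact ha.1
  · intro m h1 hm
    dsimp only
    split_ifs with h2 h3 h3
    · exact hjc.2 m h1 (by omega)
    · obtain rfl : m = j := by omega
      rw [descent_self]
      exact ha.2 m h1 hm
    · omega
    · exact ha.2 m h1 hm
  · dsimp only
    split_ifs with hIj
    · obtain rfl : I = j := by omega
      exact descent_self _ _
    · rfl
  · intro m h1 hm x hx
    by_cases hmj : m ≤ j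
    · exact hjS m hmj x (by simpa [hmj] using hx.block_eq)
    · have hu : Used a m x := by
        refine hx.congr ?_ (by simp [hmj])
        split_ifs with h2
        · rw [show m - 1 = j by omega, descent_self]
        · rfl
      exact fun hxS => hD x hxS (haS m h1 hm x hu) (hdeep m (by omega) hm x hu)

/-- Few pebbles leave one of the upper roots open. -/
theorem exists_isOpen {s k : ℕ} {root : ℕ → ℕ} (hroot : ∀ i, 2 ≤ i → i ≤ s → IsCell s i (root i))
    {S : Finset PNode} (hS : S.card < k) (hs : 8 * k ≤ s) :
    ∃ i, 7 * k ≤ i ∧ i ≤ s ∧ IsOpen s S i (root i) := by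
  -- Here the roots themselves are the cells to be avoided, so the descents from different roots are
  -- disjoint.
  obtain ⟨i, hi, hiS⟩ := exists_free_descent S root (Finset.Icc (7 * k) (8 * k)) (by
    rw [Nat.card_Icc]; omega)
  rw [Finset.mem_Icc] at hi
  exact ⟨i, hi.1, by omega, descent root i,
    isClimb_descent (hroot i (by omega) (by omega)), descent_self _ _,
    fun m _ hm x hx => hiS m hm x hx.block_eq⟩

end PNode

/-! ### Layered graphs -/

namespace Dag

/-- The node `v` is needed after time `t`: it is a predecessor of a node that is computed at some
time `i ≥ t` such that `v` has not been computed from time `t` until then. -/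
def Needed {G : Dag} (comp : ℕ → G.V → Prop) (t : ℕ) (v : G.V) : Prop :=
  ∃ i, t ≤ i ∧ ∃ u, G.E v u ∧ comp i u ∧ ∀ i', t ≤ i' → i' < i → ¬ comp i' v

/-- A pebble present later was present before or has been placed in between. -/
theorem Needed.or_comp {G : Dag} {comp : ℕ → G.V → Prop} {t t' : ℕ} {v : G.V} (ht : t ≤ t')
    (h : Needed comp t' v) : Needed comp t v ∨ ∃ i, t ≤ i ∧ i < t' ∧ comp i v := by
  obtain ⟨i, hi, u, hu, hc, hn⟩ := h
  by_cases hv : ∃ i, t ≤ i ∧ i < t' ∧ comp i v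
  · exact Or.inr hv
  · refine Or.inl ⟨i, by omega, u, hu, hc, fun i' h1 h2 hc' => ?_⟩
    by_cases h3 : i' < t'
    · exact hv ⟨i', h1, h3, hc'⟩
    · exact hn i' (by omega) h2 hc'

/-- This is the pebbling rule: a node is computed only when each predecessor is already pebbled or
has been computed since. -/
theorem needed_or_comp_of_comp {G : Dag} {comp : ℕ → G.V → Prop} {t i : ℕ} {u v : G.V}
    (ht : t ≤ i) (he : G.E v u) (hc : comp i u) :
    Needed comp t v ∨ ∃ i', t ≤ i' ∧ i' < i ∧ comp i' v := by
  by_cases hv : ∃ i', t ≤ i' ∧ i' < i ∧ comp i' v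
  · exact Or.inr hv
  · exact Or.inl ⟨i, ht, u, he, hc, fun i' h1 h2 hc' => hv ⟨i', h1, h2, hc'⟩⟩

variable {G : Dag} {Y : Set G.V} {m : ℕ}

/-- The original of a node of the layered graph. -/
def layerProj : (G.layer Y m).V → G.V := Sum.elim id fun p => p.2.1

/-- The number of the copy to which a node of the layered graph belongs. -/
def layerIdx : (G.layer Y m).V → Option (Fin m) := Sum.elim (fun _ => none) fun p => some p.1

theorem exists_layer_edge (x : (G.layer Y m).V) {u : G.V} (h : G.E u (layerProj x)) :
    ∃ u', layerProj u' = u ∧ (G.layer Y m).E u' x := by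
  rcases x with x | ⟨i, x⟩
  · exact ⟨Sum.inl u, rfl, .orig _ _ h⟩
  · by_cases hu : u ∈ Y
    · exact ⟨Sum.inr (i, ⟨u, hu⟩), rfl, .within i ⟨u, hu⟩ x h⟩
    · exact ⟨Sum.inl u, rfl, .into i u x hu h⟩

theorem layerIdx_eq_of_edge {x y : (G.layer Y m).V} (h : (G.layer Y m).E x y)
    (hx : layerProj x ∈ Y) : layerIdx x = layerIdx y := by
  cases h with
  | orig => rfl
  | within => rfl
  | into i u v hu => exact absurd hx hu

theorem layer_ext {x y : (G.layer Y m).V} (h : layerProj x = layerProj y)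
    (hi : layerIdx x = layerIdx y) : x = y := by
  rcases x with x | ⟨i, x⟩ <;> rcases y with y | ⟨j, y⟩
  · exact congrArg Sum.inl h
  · simp [layerIdx] at hi
  · simp [layerIdx] at hi
  · have h1 : i = j := by simpa [layerIdx] using hi
    have h2 : x = y := Subtype.ext h
    rw [h1, h2]

end Dag

/-! ### Pebbling the layered graph -/

namespace HardGraph

open PNode Dag

variable {s c₁ : ℕ} {root : ℕ → ℕ}

/-- The name of the original of a node. -/
def name (x : (hardGraph s c₁ root).V) : PNode := (layerProj x).1

/-- The number of the copy of a node. -/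
def copy (x : (hardGraph s c₁ root).V) : Option (Fin (s - 1)) := layerIdx x

theorem valid_name (x : (hardGraph s c₁ root).V) : Valid s c₁ (name x) := (layerProj x).2

theorem exists_edge (x : (hardGraph s c₁ root).V) {u : PNode} (hu : Valid s c₁ u)
    (h : Edge s c₁ root u (name x)) :
    ∃ u', name u' = u ∧ (hardGraph s c₁ root).E u' x := by
  obtain ⟨u', h1, h2⟩ := exists_layer_edge (G := baseGraph s c₁ root) x (u := ⟨u, hu⟩) h
  exact ⟨u', congrArg Subtype.val h1, h2⟩

theorem copy_eq_of_edge {x y : (hardGraph s c₁ root).V} (h : (hardGraph s c₁ root).E x y) {l : ℕ}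
    (hx : name x = w l) : copy x = copy y :=
  layerIdx_eq_of_edge h (Or.inr (Or.inr ⟨l, hx⟩))

theorem ext_of_name_copy {x y : (hardGraph s c₁ root).V} (h : name x = name y)
    (hi : copy x = copy y) : x = y :=
  layer_ext (Subtype.ext h) hi

/-- The names of the needed nodes. -/
noncomputable def neededNames (comp : ℕ → (hardGraph s c₁ root).V → Prop) (t : ℕ) :
    Finset PNode :=
  haveI := (hardGraph s c₁ root).finite
  (Set.toFinite (name '' {v | Needed comp t v})).toFinset

theorem mem_neededNames {comp : ℕ → (hardGraph s c₁ root).V → Prop} {t : ℕ} {x : PNode} :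
    x ∈ neededNames comp t ↔ ∃ v, Needed comp t v ∧ name v = x := by
  simp [neededNames]

theorem card_neededNames_le (comp : ℕ → (hardGraph s c₁ root).V → Prop) (t : ℕ) :
    (neededNames comp t).card ≤ {v | Needed comp t v}.ncard := by
  have := (hardGraph s c₁ root).finite
  rw [neededNames, ← Set.ncard_eq_toFinset_card _ (Set.toFinite _)]
  exact Set.ncard_image_le (Set.toFinite _)

/-- Depth is defined on names and speaks of all copies at once, which reduces the layered graph to
the base graph. -/
theorem isDepth (comp : ℕ → (hardGraph s c₁ root).V → Prop) (t : ℕ) :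
    IsDepth s c₁ root (neededNames comp t)
      fun g x => ∀ y, name y = x → ∀ i, t ≤ i → i < t + g → ¬ comp i y where
  zero _ _ _ i h1 h2 := by omega
  anti g x h y hy i h1 h2 := h y hy i h1 (by omega)
  invalid g x hx y hy := absurd (hy ▸ valid_name y) hx
  step g x y hx he hxS hD z hz i h1 h2 hc := by
    subst hz
    obtain ⟨u, rfl, hu⟩ := exists_edge z hx he
    rcases needed_or_comp_of_comp h1 hu hc with hn | ⟨i', h3, h4, h5⟩
    · exact hxS (mem_neededNames.mpr ⟨u, hn, rfl⟩)
    · exact hD u rfl i' h3 (by omega) h5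

/-- If few nodes are needed at all times that are `small`, and such times occur frequently, then
one of the upper roots is never computed. -/
theorem exists_root_not_comp {k : ℕ} (hs : 8 * k ≤ s)
    (hroot : ∀ i, 2 ≤ i → i ≤ s → IsCell s i (root i))
    (comp : ℕ → (hardGraph s c₁ root).V → Prop) (alive small : ℕ → Prop)
    (halive : ∀ t, alive (t + 1) → alive t) (hcomp : ∀ t y, comp t y → alive t)
    (hsmall0 : small 0) (hsmall : ∀ t, small t → {v | Needed comp t v}.ncard < k)
    (hrun : ∀ t₀ t, t₀ ≤ t → alive t → (∀ j, t₀ < j → j ≤ t → ¬ small j) →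
      t < t₀ + 2 * k * k) :
    ∃ i, 7 * k ≤ i ∧ i ≤ s ∧ ∀ y, name y = cell i (root i) →
      ¬ Needed comp 0 y ∧ ∀ t, ¬ comp t y := by
  have hcard : ∀ t, small t → (neededNames comp t).card < k := fun t ht =>
    (card_neededNames_le comp t).trans_lt (hsmall t ht)
  obtain ⟨i, hi, his, ho⟩ := exists_isOpen hroot (hcard 0 hsmall0) hs
  have hk : 0 < k := (Nat.zero_le _).trans_lt (hsmall 0 hsmall0)
  -- Invariant: the root is open with respect to the nodes needed at the latest small time `t₀`.
  have hinv : ∀ t, alive t → ∃ t₀, t₀ ≤ t ∧ small t₀ ∧ (∀ j, t₀ < j → j ≤ t → ¬ small j) ∧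
      IsOpen s (neededNames comp t₀) i (root i) := by
    intro t
    induction t with
    | zero => exact fun _ => ⟨0, le_rfl, hsmall0, fun j h1 h2 => by omega, ho⟩
    | succ t ih =>
      intro ht
      have hat := halive t ht
      obtain ⟨t₀, h1, h2, h3, h4⟩ := ih hat
      by_cases hst : small (t + 1)
      · refine ⟨t + 1, le_rfl, hst, fun j h1 h2 => by omega, ?_⟩
        refine h4.next (isDepth comp t₀) (hcard _ h2) (hcard _ hst) hi fun x hx hx' hD => ?_
        obtain ⟨y, hy, rfl⟩ := mem_neededNames.mp hx
        -- A node needed now but not at `t₀` was computed in between, within `2 * k * k` steps, and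
        -- so is not deep.
        rcases hy.or_comp (t := t₀) (by omega) with hn | ⟨j, hj, hj', hc⟩
        · exact hx' (mem_neededNames.mpr ⟨y, hn, rfl⟩)
        · have := hrun t₀ t h1 hat h3
          exact hD y rfl j hj (by omega) hc
      · refine ⟨t₀, by omega, h2, fun j h5 h6 => ?_, h4⟩
        rcases Nat.lt_or_ge t j with h7 | h7
        · obtain rfl : j = t + 1 := by omega
          exact hst
        · exact h3 j h5 h7
  refine ⟨i, hi, his, fun y hy => ⟨fun hn => ?_, fun t hc => ?_⟩⟩
  · obtain ⟨a, -, ha, haS⟩ := ho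
    exact haS i (by omega) le_rfl (name y) (Or.inl (by rw [hy, ha]))
      (mem_neededNames.mpr ⟨y, hn, rfl⟩)
  · have hat := hcomp t y hc
    obtain ⟨t₀, h1, h2, h3, h4⟩ := hinv t hat
    exact h4.deep (isDepth comp t₀) (hcard _ h2) (by omega) y hy t h1
      (hrun t₀ t h1 hat h3) hc

/-- A target can only be computed if some node of the same copy is needed. -/
theorem exists_needed_of_comp_sink {k : ℕ} (hs : 8 * k ≤ s)
    (hroot : ∀ i, 2 ≤ i → i ≤ s → IsCell s i (root i))
    (comp : ℕ → (hardGraph s c₁ root).V → Prop) (alive small : ℕ → Prop)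
    (halive : ∀ t, alive (t + 1) → alive t) (hcomp : ∀ t y, comp t y → alive t)
    (hsmall0 : small 0) (hsmall : ∀ t, small t → {v | Needed comp t v}.ncard < k)
    (hrun : ∀ t₀ t, t₀ ≤ t → alive t → (∀ j, t₀ < j → j ≤ t → ¬ small j) →
      t < t₀ + 2 * k * k)
    {y : (hardGraph s c₁ root).V} (hy : name y = w (s - 1)) {t : ℕ} (hc : comp t y) :
    ∃ y', Needed comp 0 y' ∧ copy y' = copy y := by
  obtain ⟨i, hi, his, hno⟩ :=
    exists_root_not_comp hs hroot comp alive small halive hcomp hsmall0 hsmall hrun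
  have hk : 0 < k := (Nat.zero_le _).trans_lt (hsmall 0 hsmall0)
  by_contra hcon
  -- The root `r_i` feeds `w (i - 1)`. From there to the target, each node of the path in this copy
  -- lacks a predecessor that is neither needed at time 0 nor ever computed.
  have key : ∀ d, i - 1 + d ≤ s - 1 → ∀ x, name x = w (i - 1 + d) → copy x = copy y →
      ∀ t, ¬ comp t x := by
    intro d
    induction d with
    | zero =>
      intro _ x hx _ t hct
      obtain ⟨u, hu, he⟩ := exists_edge x (u := cell i (root i)) (hroot i (by omega) his) (by
        rw [hx]; exact .wRoot i (by omega) his)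
      obtain ⟨h1, h2⟩ := hno u hu
      rcases needed_or_comp_of_comp (Nat.zero_le t) he hct with h | ⟨j, -, -, h⟩
      · exact h1 h
      · exact h2 j h
    | succ d ih =>
      intro hd x hx hxy t hct
      obtain ⟨u, hu, he⟩ := exists_edge x (u := w (i - 1 + d)) ⟨by omega, by omega⟩ (by
        rw [hx]; exact .wPath _)
      have hcu : copy u = copy y := (copy_eq_of_edge he hu).trans hxy
      rcases needed_or_comp_of_comp (Nat.zero_le t) he hct with h | ⟨j, -, -, h⟩
      · exact hcon ⟨u, h, hcu⟩
      · exact ih (by omega) u hu hcu j h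
  refine key (s - i) (by omega) y ?_ rfl t hc
  rw [hy]; congr 1; omega

/-! ### The targets and the size of the layered graph -/

theorem exists_succ_of_base (hs : 2 ≤ s) (hc₁ : 1 ≤ c₁)
    (hroot : ∀ i, 2 ≤ i → i ≤ s → IsCell s i (root i)) {x : PNode} (hx : Valid s c₁ x)
    (hne : x ≠ w (s - 1)) : ∃ y, Valid s c₁ y ∧ Edge s c₁ root x y := by
  have hcs : 1 ≤ c₁ * s := Nat.mul_pos hc₁ (by omega)
  cases x with
  | cell i j =>
    obtain ⟨h1, h2, h3⟩ : IsCell s i j := hx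
    by_cases his : i = s
    · subst his
      obtain rfl : j = root i := by
        obtain ⟨-, h4, h5⟩ := hroot i hs le_rfl
        omega
      exact ⟨v 1, ⟨le_rfl, hcs⟩, .vFirst⟩
    · obtain rfl | hj : j = 1 ∨ 2 ≤ j := by omega
      · by_cases ht : IsTriple s (i + 1) 1
        · exact ⟨gad (i + 1) 1 0, ht, .gadLeft _ _⟩
        · exact ⟨cell (i + 1) 1, ⟨by omega, le_rfl, by omega⟩, .left _ _ ht⟩
      · obtain ⟨j, rfl⟩ : ∃ j', j = j' + 1 := ⟨j - 1, by omega⟩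
        by_cases ht : IsTriple s (i + 1) j
        · exact ⟨gad (i + 1) j 2, ht, .gadRight _ _⟩
        · exact ⟨cell (i + 1) j, ⟨by omega, by omega, by omega⟩, .right _ _ ht⟩
  | gad i j p =>
    have ht : IsTriple s i j := hx
    have hcell : Valid s c₁ (cell i j) := by
      obtain ⟨-, -, h, -⟩ := ht
      exact h
    fin_cases p
    · exact ⟨gad i j 3, ht, .mid03 _ _⟩
    · exact ⟨gad i j 3, ht, .mid13 _ _⟩
    · exact ⟨gad i j 4, ht, .mid24 _ _⟩
    · exact ⟨cell i j, hcell, .apex3 _ _⟩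
    · exact ⟨cell i j, hcell, .apex4 _ _⟩
  | v k =>
    obtain ⟨h1, h2⟩ : 1 ≤ k ∧ k ≤ c₁ * s := hx
    obtain rfl | hk : k = c₁ * s ∨ k < c₁ * s := by omega
    · exact ⟨w 1, ⟨le_rfl, by omega⟩, .wFirst⟩
    · exact ⟨v (k + 1), ⟨by omega, by omega⟩, .vPath _⟩
  | w l =>
    obtain ⟨h1, h2⟩ : 1 ≤ l ∧ l + 1 ≤ s := hx
    have : l ≠ s - 1 := fun h => hne (by rw [h])
    exact ⟨w (l + 1), ⟨by omega, by omega⟩, .wPath _⟩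

theorem isSink_iff (hs : 2 ≤ s) (hc₁ : 1 ≤ c₁)
    (hroot : ∀ i, 2 ≤ i → i ≤ s → IsCell s i (root i)) (x : (hardGraph s c₁ root).V) :
    (hardGraph s c₁ root).IsSink x ↔ name x = w (s - 1) := by
  constructor
  · intro h
    by_contra hne
    rcases x with x | ⟨c, x, hx⟩
    · obtain ⟨y, hy, he⟩ := exists_succ_of_base hs hc₁ hroot x.2 hne
      exact h (Sum.inl ⟨y, hy⟩) (.orig x ⟨y, hy⟩ he)
    -- A copied node keeps only its edges inside `Y`, so its successor must be found on the path
    -- `w`.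
    · have hin : ∀ l, Valid s c₁ (w l) → ¬ Edge s c₁ root x.1 (w l) := fun l hl he =>
        h (Sum.inr (c, ⟨⟨w l, hl⟩, Or.inr (Or.inr ⟨l, rfl⟩)⟩)) (.within c ⟨x, hx⟩ ⟨⟨w l, hl⟩, _⟩ he)
      have hne : x.1 ≠ w (s - 1) := hne
      rcases hx with ⟨i, h1, h2, h3⟩ | h3 | ⟨l, h3⟩
      · exact hin (i - 1) ⟨by omega, by omega⟩ (by rw [h3]; exact .wRoot i h1 h2)
      · exact hin 1 ⟨le_rfl, hs⟩ (by rw [h3]; exact .wFirst)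
      · have hl : 1 ≤ l ∧ l + 1 ≤ s := by simpa [h3, Valid] using x.2
        have : l ≠ s - 1 := fun h => hne (h3.trans (by rw [h]))
        exact hin (l + 1) ⟨by omega, by omega⟩ (by rw [h3]; exact .wPath l)
  · intro hx y he
    have key : ∀ y : PNode, Valid s c₁ y → ¬ Edge s c₁ root (w (s - 1)) y := by
      intro y hy he
      cases he
      obtain ⟨-, h⟩ : 1 ≤ _ ∧ s - 1 + 1 + 1 ≤ s := hy
      omega
    cases he with
    | orig u v he => exact key _ v.2 (hx ▸ he)
    | within i u v he => exact key _ v.1.2 (hx ▸ he)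
    | into i u v hu he => exact key _ v.1.2 (hx ▸ he)

/-- Each copy has exactly one target; `none` stands for the original and `some c` for an added copy.
-/
theorem card_sinks (hs : 2 ≤ s) (hc₁ : 1 ≤ c₁)
    (hroot : ∀ i, 2 ≤ i → i ≤ s → IsCell s i (root i)) :
    Nat.card {x : (hardGraph s c₁ root).V // (hardGraph s c₁ root).IsSink x} = s := by
  have hw : Valid s c₁ (w (s - 1)) := ⟨by omega, by omega⟩
  have : Function.Bijective
      fun x : {x : (hardGraph s c₁ root).V // (hardGraph s c₁ root).IsSink x} => copy x.1 := by
    constructor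
    · rintro ⟨x, hx⟩ ⟨y, hy⟩ h
      rw [isSink_iff hs hc₁ hroot] at hx hy
      exact Subtype.ext (ext_of_name_copy (hx.trans hy.symm) h)
    · rintro (_ | c)
      · exact ⟨⟨Sum.inl ⟨_, hw⟩, (isSink_iff hs hc₁ hroot _).mpr rfl⟩, rfl⟩
      · exact ⟨⟨Sum.inr (c, ⟨⟨_, hw⟩, Or.inr (Or.inr ⟨_, rfl⟩)⟩),
          (isSink_iff hs hc₁ hroot _).mpr rfl⟩, rfl⟩
  rw [Nat.card_eq_of_bijective _ this]
  simp
  omega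

theorem card_base_le (s c₁ : ℕ) (root : ℕ → ℕ) :
    Nat.card (baseGraph s c₁ root).V ≤ 6 * s ^ 2 + c₁ * s + s := by
  let f : (Fin s × Fin s) ⊕ (Fin s × Fin s × Fin 5) ⊕ Fin (c₁ * s) ⊕ Fin s → PNode :=
    Sum.elim (fun p => cell (p.1 + 1) (p.2 + 1))
      (Sum.elim (fun p => gad (p.1 + 1) (p.2.1 + 1) p.2.2)
        (Sum.elim (fun k => v (k + 1)) (fun l => w (l + 1))))
  have hsub : {x | Valid s c₁ x} ⊆ Set.range f := by
    intro x hx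
    cases x with
    | cell i j =>
      obtain ⟨h1, h2, h3⟩ : IsCell s i j := hx
      refine ⟨Sum.inl (⟨i - 1, by omega⟩, ⟨j - 1, by omega⟩), ?_⟩
      simp only [f, Sum.elim_inl]; congr 1 <;> omega
    | gad i j p =>
      obtain ⟨-, j', ⟨h1, h2, h3⟩, -⟩ : IsTriple s i j := hx
      refine ⟨Sum.inr (Sum.inl (⟨i - 1, by omega⟩, ⟨j - 1, by omega⟩, p)), ?_⟩
      simp only [f, Sum.elim_inl, Sum.elim_inr]; congr 1 <;> omega
    | v k =>
      obtain ⟨h1, h2⟩ : 1 ≤ k ∧ k ≤ c₁ * s := hx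
      refine ⟨Sum.inr (Sum.inr (Sum.inl ⟨k - 1, by omega⟩)), ?_⟩
      simp only [f, Sum.elim_inl, Sum.elim_inr]; congr 1; omega
    | w l =>
      obtain ⟨h1, h2⟩ : 1 ≤ l ∧ l + 1 ≤ s := hx
      refine ⟨Sum.inr (Sum.inr (Sum.inr ⟨l - 1, by omega⟩)), ?_⟩
      simp only [f, Sum.elim_inr]; congr 1; omega
  calc Nat.card (baseGraph s c₁ root).V = {x | Valid s c₁ x}.ncard := rfl
    _ ≤ (Set.range f).ncard := Set.ncard_le_ncard hsub (Set.finite_range f)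
    _ ≤ Nat.card ((Fin s × Fin s) ⊕ (Fin s × Fin s × Fin 5) ⊕ Fin (c₁ * s) ⊕ Fin s) := by
      rw [← Set.image_univ, ← Set.ncard_univ]
      exact Set.ncard_image_le
    _ = 6 * s ^ 2 + c₁ * s + s := by simp; ring

theorem card_frontierSet_le (s c₁ : ℕ) (root : ℕ → ℕ) :
    (frontierSet s c₁ root).ncard ≤ 2 * s + 1 := by
  let f : Fin s ⊕ Fin s ⊕ Unit → PNode :=
    Sum.elim (fun i => cell (i + 1) (root (i + 1)))
      (Sum.elim (fun l => w (l + 1)) (fun _ => v (c₁ * s)))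
  have hsub : Subtype.val '' frontierSet s c₁ root ⊆ Set.range f := by
    rintro _ ⟨x, ⟨i, h1, h2, h3⟩ | h3 | ⟨l, h3⟩, rfl⟩
    · refine ⟨Sum.inl ⟨i - 1, by omega⟩, ?_⟩
      rw [h3]; simp only [f, Sum.elim_inl]; rw [show i - 1 + 1 = i by omega]
    · exact ⟨Sum.inr (Sum.inr ()), h3.symm⟩
    · obtain ⟨h1, h2⟩ : 1 ≤ l ∧ l + 1 ≤ s := by simpa [h3, Valid] using x.2
      refine ⟨Sum.inr (Sum.inl ⟨l - 1, by omega⟩), ?_⟩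
      rw [h3]; simp only [f, Sum.elim_inl, Sum.elim_inr]; congr 1; omega
  calc (frontierSet s c₁ root).ncard = (Subtype.val '' frontierSet s c₁ root).ncard :=
        (Set.ncard_image_of_injective _ Subtype.val_injective).symm
    _ ≤ (Set.range f).ncard := Set.ncard_le_ncard hsub (Set.finite_range f)
    _ ≤ Nat.card (Fin s ⊕ Fin s ⊕ Unit) := by
      rw [← Set.image_univ, ← Set.ncard_univ]
      exact Set.ncard_image_le
    _ = 2 * s + 1 := by simp; ring

theorem card_le (c₁ : ℕ) (root : ℕ → ℕ) (hs : 2 ≤ s) :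
    Nat.card (hardGraph s c₁ root).V ≤ (c₁ + 9) * s ^ 2 := by
  have := (baseGraph s c₁ root).finite
  have h1 : Nat.card (hardGraph s c₁ root).V =
      Nat.card (baseGraph s c₁ root).V + (s - 1) * (frontierSet s c₁ root).ncard := by
    change Nat.card ((baseGraph s c₁ root).V ⊕ (Fin (s - 1) × frontierSet s c₁ root)) = _
    rw [Nat.card_sum, Nat.card_prod, Nat.card_fin]
    rfl
  have h2 := card_base_le s c₁ root
  have h3 := Nat.mul_le_mul_left (s - 1) (card_frontierSet_le s c₁ root)
  obtain ⟨r, rfl⟩ : ∃ r, s = r + 1 := ⟨s - 1, by omega⟩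
  rw [Nat.add_sub_cancel] at h1 h3
  rw [h1]
  nlinarith [Nat.zero_le (c₁ * r), Nat.zero_le (c₁ * r ^ 2)]

end HardGraph

/-! ### Runs of parallel oracle algorithms -/

namespace PromAlgorithm

variable {Query Out : Type} {κ : ℕ} (A : PromAlgorithm Query κ Out)

/-- The queries between the configurations `i` and `i + 1`. -/
def asked (O : Query → BitVec κ) (x : List Bool) (ρ : Fin A.coins → Bool) (i : ℕ) : List Query :=
  if (A.run O x ρ i).halted then [] else A.batch (i + 1) (A.run O x ρ i).state ρ

variable {A} {O O' : Query → BitVec κ} {x x' : List Bool} {ρ : Fin A.coins → Bool}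

theorem run_succ_of_halted {i : ℕ} (h : (A.run O x ρ i).halted = true) :
    A.run O x ρ (i + 1) = A.run O x ρ i := by
  rw [run]; simp [h]

theorem run_of_halted {i j : ℕ} (h : (A.run O x ρ i).halted = true) (hij : i ≤ j) :
    A.run O x ρ j = A.run O x ρ i := by
  induction j, hij using Nat.le_induction with
  | base => rfl
  | succ j _ ih => rw [run_succ_of_halted (ih ▸ h), ih]

theorem not_halted_of_le {i j : ℕ} (hij : i ≤ j) (h : (A.run O x ρ j).halted = false) :
    (A.run O x ρ i).halted = false := by
  by_contra hi
  rw [Bool.not_eq_false] at hi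
  rw [run_of_halted hi hij, hi] at h
  exact absurd h (by simp)

theorem not_halted_of_mem_asked {i : ℕ} {q : Query} (h : q ∈ A.asked O x ρ i) :
    (A.run O x ρ i).halted = false := by
  by_contra hi
  rw [Bool.not_eq_false] at hi
  simp [asked, hi] at h

theorem queries_succ (i : ℕ) :
    (A.run O x ρ (i + 1)).queries = (A.run O x ρ i).queries + (A.asked O x ρ i).length := by
  rw [run, asked]
  by_cases h : (A.run O x ρ i).halted = true
  · simp [h]
  · simp [h]

theorem queries_mono : Monotone fun i => (A.run O x ρ i).queries :=
  monotone_nat_of_le_succ fun i => by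
    simp only [queries_succ]; omega

theorem length_asked_le {P : ℕ} (hP : (A.run O x ρ P).halted = true)
    (hq : (A.run O x ρ P).queries ≤ P) (i : ℕ) : (A.asked O x ρ i).length ≤ P := by
  rcases Nat.lt_or_ge i P with hi | hi
  · have h1 := queries_succ (A := A) (O := O) (x := x) (ρ := ρ) i
    have h2 : (A.run O x ρ (i + 1)).queries ≤ (A.run O x ρ P).queries := queries_mono hi
    omega
  · simp [asked, run_of_halted hP hi, hP]

/-- What is common to two configurations with the same continuation. -/
def Agree (c c' : PromConfig Out) : Prop := c.state = c'.state ∧ c.halted = c'.halted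

theorem asked_eq_of_agree {i : ℕ} (h : Agree (A.run O x ρ i) (A.run O' x' ρ i)) :
    A.asked O x ρ i = A.asked O' x' ρ i := by
  rw [asked, asked, h.1, h.2]

/-- A computation resumes from its state and halting flag alone. The output register is never read,
so its equality has to be assumed separately. -/
theorem run_agree {t i : ℕ} (ht : t ≤ i) (h : Agree (A.run O x ρ t) (A.run O' x' ρ t))
    (hq : ∀ j, t ≤ j → j < i → ∀ q ∈ A.asked O x ρ j, O q = O' q) :
    Agree (A.run O x ρ i) (A.run O' x' ρ i) ∧
      ((A.run O x ρ t).out = (A.run O' x' ρ t).out →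
        (A.run O x ρ i).out = (A.run O' x' ρ i).out) := by
  induction i, ht using Nat.le_induction with
  | base => exact ⟨h, id⟩
  | succ i hi ih =>
    obtain ⟨ih1, ih2⟩ := ih fun j h1 h2 => hq j h1 (by omega)
    have hmap := hq i hi (by omega)
    obtain ⟨e1, e2⟩ := ih1
    rw [run, run]
    unfold asked at hmap
    by_cases hh : (A.run O x ρ i).halted = true
    · have hh' : (A.run O' x' ρ i).halted = true := e2 ▸ hh
      simp only [hh, hh', if_true]
      exact ⟨⟨e1, e2⟩, ih2⟩
    · have hh' : ¬ (A.run O' x' ρ i).halted = true := e2 ▸ hh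
      simp only [hh, hh', if_false, Bool.false_eq_true] at hmap ⊢
      rw [← e1, ← List.map_congr_left hmap]
      exact ⟨⟨rfl, rfl⟩, fun ho => by rw [ih2 ho]⟩

end PromAlgorithm

/-! ### Compression -/

theorem Nat.card_bitVec (k : ℕ) : Nat.card (BitVec k) = 2 ^ k := by
  rw [Nat.card_congr ⟨BitVec.toFin, BitVec.ofFin, fun _ => rfl, fun _ => rfl⟩, Nat.card_fin]

theorem BitVec.finite (k : ℕ) : Finite (BitVec k) :=
  Finite.of_injective (fun x : BitVec k => x.toFin) fun _ _ h => BitVec.eq_of_toFin_eq h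

section Compression

variable {G : Dag} {κ ℓ : ℕ}

open Classical in
/-- The oracle input that determines the label of `v`. -/
noncomputable def Dag.point (G : Dag) (ζ : BitVec κ) (O : OracleInput G κ ℓ → BitVec κ)
    (v : G.V) : OracleInput G κ ℓ :=
  if ∃ u, G.E u v then .inner v fun u => label G O ζ u.1 else .source v ζ

namespace Dag

variable {ζ : BitVec κ} {O O' : OracleInput G κ ℓ → BitVec κ}

theorem label_eq_point (v : G.V) : label G O ζ v = (O (G.point ζ O v)).setWidth ℓ := by
  rw [label_eq, point]; split_ifs <;> rfl

/-- A query for `u` carries the labels of its predecessors; this is how a label is read off before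
its own query. -/
theorem label_eq_of_point_eq {u v : G.V} (he : G.E v u) (h : G.point ζ O u = G.point ζ O' u) :
    label G O ζ v = label G O' ζ v := by
  have hex : ∃ v, G.E v u := ⟨v, he⟩
  rw [point, point, if_pos hex, if_pos hex] at h
  injection h with _ h
  exact congrFun h ⟨v, he⟩

theorem eq_of_point_eq {u v : G.V}
    (huv : G.point ζ O u = G.point ζ O' v) : u = v := by
  unfold point at huv
  split_ifs at huv <;> injection huv

theorem point_ne_msg (v : G.V) (x : BitVec κ) : G.point ζ O v ≠ .msg x := by
  unfold point
  split_ifs <;> simp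

theorem point_congr {v : G.V} (h : ∀ u, G.E u v → label G O ζ u = label G O' ζ u) :
    G.point ζ O v = G.point ζ O' v := by
  unfold point
  split_ifs with hex
  · congr 1
    funext u
    exact h u.1 u.2
  · rfl

/-- Pointers to the place where the node `v` is first computed (if any) in a list of query batches
from time `t` on. -/
def FirstFits (Q : ℕ → List (OracleInput G κ ℓ)) (t : ℕ) (p : OracleInput G κ ℓ) :
    Option (ℕ × ℕ) → Prop
  | some (i, j) => t ≤ i ∧ (Q i)[j]? = some p ∧ ∀ i', t ≤ i' → i' < i → p ∉ Q i'
  | none => ∀ i, t ≤ i → p ∉ Q i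

/-- Pointers to a place where the label of the node `v` is used before it is computed. -/
def NeedFits (G : Dag) (ζ : BitVec κ) (O : OracleInput G κ ℓ → BitVec κ)
    (Q : ℕ → List (OracleInput G κ ℓ)) (t : ℕ) (v : G.V) : Option (G.V × ℕ × ℕ) → Prop
  | some (u, i, j) => t ≤ i ∧ G.E v u ∧ (Q i)[j]? = some (G.point ζ O u) ∧
      ∀ i', t ≤ i' → i' < i → G.point ζ O v ∉ Q i'
  | none => ∀ i, t ≤ i → G.point ζ O v ∉ Q i

/-- Once the label is known, the low bits of the masked value reveal the payload, and removing the
payload restores the full oracle value. -/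
theorem eq_and_eq_of_xor_eq {a b : BitVec κ} {c d : BitVec ℓ} (hℓ : ℓ ≤ κ)
    (h : a ^^^ c.setWidth κ = b ^^^ d.setWidth κ) (hab : a.setWidth ℓ = b.setWidth ℓ) :
    c = d ∧ a = b := by
  have hcd : c = d := by
    have h1 := congrArg (BitVec.setWidth ℓ) h
    rw [BitVec.setWidth_xor, BitVec.setWidth_xor, hab, BitVec.xor_right_inj,
      BitVec.setWidth_setWidth_of_le _ hℓ, BitVec.setWidth_setWidth_of_le _ hℓ] at h1
    simpa using h1
  subst hcd
  exact ⟨rfl, by simpa using h⟩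

/-- **Compression.** If the labels of `k` nodes can be read off from a computation before they are
computed, at places that are fixed in advance, then this happens for few oracles. -/
theorem card_mul_two_pow_le (hℓ : ℓ ≤ κ) (B : Set (OracleInput G κ ℓ → BitVec κ))
    (Q : (OracleInput G κ ℓ → BitVec κ) → ℕ → List (OracleInput G κ ℓ)) (t : ℕ) {k : ℕ}
    (v : Fin k → G.V) (hv : Function.Injective v) (need : Fin k → Option (G.V × ℕ × ℕ))
    (first : Fin k → Option (ℕ × ℕ))
    (hdet : ∀ O ∈ B, ∀ O' ∈ B, ∀ i, t ≤ i →
      (∀ j, t ≤ j → j < i → ∀ q ∈ Q O j, O q = O' q) → Q O i = Q O' i)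
    (hfirst : ∀ O ∈ B, ∀ a, FirstFits (Q O) t (G.point ζ O (v a)) (first a))
    (hneed : ∀ O ∈ B, ∀ a, NeedFits G ζ O (Q O) t (v a) (need a))
    (hout : ∀ O ∈ B, ∀ O' ∈ B, (∀ i, t ≤ i → ∀ q ∈ Q O i, O q = O' q) →
      (∀ x, O (.msg x) = O' (.msg x)) →
      ∀ a, need a = none → label G O ζ (v a) = label G O' ζ (v a)) :
    Nat.card B * 2 ^ (ℓ * k) ≤ Nat.card (OracleInput G κ ℓ → BitVec κ) := by
  classical
  have hfin : Finite (OracleInput G κ ℓ) := OracleInput.finite G κ ℓ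
  have hfb := BitVec.finite
  -- The encoding hides `ℓ * k` bits of payload in the oracle, by masking the labels of the nodes `v
  -- a`. These labels are recoverable from the run, so the payload can be decoded and the map is
  -- injective.
  let Φ : B × (Fin k → BitVec ℓ) → OracleInput G κ ℓ → BitVec κ := fun p x =>
    if h : ∃ a, x = G.point ζ p.1.1 (v a) then p.1.1 x ^^^ (p.2 h.choose).setWidth κ else p.1.1 x
  have hΦ1 : ∀ p a, Φ p (G.point ζ p.1.1 (v a)) =
      p.1.1 (G.point ζ p.1.1 (v a)) ^^^ (p.2 a).setWidth κ := by
    intro p a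
    have hex : ∃ a', G.point ζ p.1.1 (v a) = G.point ζ p.1.1 (v a') := ⟨a, rfl⟩
    have : hex.choose = a := hv (eq_of_point_eq hex.choose_spec).symm
    simp only [Φ, dif_pos hex, this]
  have hΦ2 : ∀ p x, (∀ a, x ≠ G.point ζ p.1.1 (v a)) → Φ p x = p.1.1 x := by
    intro p x hx
    have : ¬ ∃ a, x = G.point ζ p.1.1 (v a) := fun ⟨a, ha⟩ => hx a ha
    simp only [Φ, dif_neg this]
  have hinj : Function.Injective Φ := by
    rintro ⟨⟨O, hO⟩, z⟩ ⟨⟨O', hO'⟩, z'⟩ h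
    have hval : ∀ a, G.point ζ O (v a) = G.point ζ O' (v a) →
        label G O ζ (v a) = label G O' ζ (v a) →
        z a = z' a ∧ O (G.point ζ O (v a)) = O' (G.point ζ O (v a)) := by
      intro a hp hl
      have h1 := hΦ1 ⟨⟨O, hO⟩, z⟩ a
      have h2 := hΦ1 ⟨⟨O', hO'⟩, z'⟩ a
      simp only at h1 h2
      rw [h, hp, h2] at h1
      rw [label_eq_point, label_eq_point, hp] at hl
      obtain ⟨e1, e2⟩ := eq_and_eq_of_xor_eq hℓ h1.symm hl
      exact ⟨e1, by rw [hp]; exact e2⟩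
    -- If the point of `v a` is queried in batch `i`, both pointers lead to batches up to `i`.
    -- Equality of these batches thus identifies the point itself and its label.
    have key : ∀ O ∈ B, ∀ O' ∈ B, ∀ i, t ≤ i → (∀ j, t ≤ j → j ≤ i → Q O j = Q O' j) →
        ∀ a, G.point ζ O (v a) ∈ Q O i →
        G.point ζ O (v a) = G.point ζ O' (v a) ∧ label G O ζ (v a) = label G O' ζ (v a) := by
      intro O hO O' hO' i hi hQ a hmem
      constructor
      · have f1 := hfirst O hO a
        have f2 := hfirst O' hO' a
        rcases hf : first a with _ | ⟨f, j⟩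
        · rw [hf] at f1
          exact absurd hmem (f1 i hi)
        · rw [hf] at f1 f2
          have hfi : f ≤ i := by
            by_contra hlt
            exact f1.2.2 i hi (by omega) hmem
          have := f1.2.1
          rw [hQ f f1.1 hfi, f2.2.1] at this
          exact (Option.some.inj this).symm
      · have f1 := hneed O hO a
        have f2 := hneed O' hO' a
        rcases hf : need a with _ | ⟨u, f, j⟩
        · rw [hf] at f1
          exact absurd hmem (f1 i hi)
        · rw [hf] at f1 f2
          have hfi : f ≤ i := by
            by_contra hlt
            exact f1.2.2.2 i hi (by omega) hmem
          have := f1.2.2.1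
          rw [hQ f f1.1 hfi, f2.2.2.1] at this
          exact label_eq_of_point_eq f1.2.1 (Option.some.inj this).symm
    -- The run is decoded batch by batch: answers to earlier batches determine the batch, and only
    -- the points of the `v a` have masked answers.
    have hrun : ∀ i, t ≤ i → Q O i = Q O' i ∧ ∀ q ∈ Q O i, O q = O' q := by
      intro i
      induction i using Nat.strong_induction_on with
      | _ i ih =>
        intro hi
        have hQi : Q O i = Q O' i := hdet O hO O' hO' i hi fun j h1 h2 => (ih j h2 h1).2
        have hQ : ∀ j, t ≤ j → j ≤ i → Q O j = Q O' j := by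
          intro j h1 h2
          rcases h2.lt_or_eq with h3 | rfl
          · exact (ih j h3 h1).1
          · exact hQi
        refine ⟨hQi, fun q hq => ?_⟩
        by_cases h1 : ∃ a, q = G.point ζ O (v a)
        · obtain ⟨a, rfl⟩ := h1
          obtain ⟨e1, e2⟩ := key O hO O' hO' i hi hQ a hq
          exact (hval a e1 e2).2
        · by_cases h2 : ∃ a, q = G.point ζ O' (v a)
          · obtain ⟨a, rfl⟩ := h2
            have := (key O' hO' O hO i hi (fun j h1 h2 => (hQ j h1 h2).symm) a (hQi ▸ hq)).1
            exact absurd ⟨a, this⟩ h1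
          · have e1 := hΦ2 ⟨⟨O, hO⟩, z⟩ q fun a ha => h1 ⟨a, ha⟩
            have e2 := hΦ2 ⟨⟨O', hO'⟩, z'⟩ q fun a ha => h2 ⟨a, ha⟩
            rw [h, e2] at e1
            exact e1.symm
    have hmsg : ∀ x, O (.msg x) = O' (.msg x) := by
      intro x
      have e1 := hΦ2 ⟨⟨O, hO⟩, z⟩ (.msg x) fun a => (point_ne_msg _ _).symm
      have e2 := hΦ2 ⟨⟨O', hO'⟩, z'⟩ (.msg x) fun a => (point_ne_msg _ _).symm
      rw [h, e2] at e1
      exact e1.symm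
    have hlab : ∀ a, label G O ζ (v a) = label G O' ζ (v a) := by
      intro a
      have f1 := hneed O hO a
      have f2 := hneed O' hO' a
      rcases hf : need a with _ | ⟨u, f, j⟩
      · exact hout O hO O' hO' (fun i hi => (hrun i hi).2) hmsg a hf
      · rw [hf] at f1 f2
        have := f1.2.2.1
        rw [(hrun f f1.1).1, f2.2.2.1] at this
        exact label_eq_of_point_eq f1.2.1 (Option.some.inj this).symm
    -- All labels follow along the graph, as the oracle is unmasked at the points of the other
    -- nodes.
    have hall : ∀ u, label G O ζ u = label G O' ζ u := by
      intro u
      induction u using G.acyclic.induction with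
      | _ u ih =>
        by_cases hu : ∃ a, u = v a
        · obtain ⟨a, rfl⟩ := hu
          exact hlab a
        · have hp := point_congr (ζ := ζ) ih
          have e1 := hΦ2 ⟨⟨O, hO⟩, z⟩ (G.point ζ O u) fun a ha => hu ⟨a, eq_of_point_eq ha⟩
          have e2 := hΦ2 ⟨⟨O', hO'⟩, z'⟩ (G.point ζ O u) fun a ha =>
            hu ⟨a, eq_of_point_eq ha⟩
          rw [h, e2] at e1
          rw [label_eq_point, label_eq_point, ← hp]
          exact congrArg _ e1.symm
    have hpt : ∀ u, G.point ζ O u = G.point ζ O' u := fun u => point_congr fun u' _ => hall u'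
    have hz : z = z' := funext fun a => (hval a (hpt _) (hlab a)).1
    have hOO : O = O' := by
      funext q
      by_cases h1 : ∃ a, q = G.point ζ O (v a)
      · obtain ⟨a, rfl⟩ := h1
        exact (hval a (hpt _) (hlab a)).2
      · have e1 := hΦ2 ⟨⟨O, hO⟩, z⟩ q fun a ha => h1 ⟨a, ha⟩
        have e2 := hΦ2 ⟨⟨O', hO'⟩, z'⟩ q fun a ha => h1 ⟨a, ha.trans (hpt _).symm⟩
        rw [h, e2] at e1
        exact e1.symm
    subst hz
    subst hOO
    rfl
  have hcard := Nat.card_le_card_of_injective Φ hinj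
  rwa [Nat.card_prod, Nat.card_fun, Nat.card_bitVec, Nat.card_fin, ← pow_mul] at hcard

end Dag

end Compression

/-- The union bound over the hints `h`, in cardinalities. -/
theorem Nat.card_mul_le_of_cover {Ω H : Type} [Finite Ω] [Finite H] {S : Set Ω} {B : H → Set Ω}
    (hcov : ∀ ω ∈ S, ∃ h, ω ∈ B h) {c N : ℕ} (hB : ∀ h, Nat.card (B h) * c ≤ N) :
    Nat.card S * c ≤ Nat.card H * N := by
  classical
  have := Fintype.ofFinite H
  choose f hf using hcov
  have h1 : Nat.card S ≤ Nat.card (Σ h, B h) :=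
    Nat.card_le_card_of_injective (fun ω : S => ⟨f ω.1 ω.2, ω.1, hf ω.1 ω.2⟩) fun a b hab => by
      obtain ⟨h1, h2⟩ := Sigma.mk.inj_iff.mp hab
      refine Subtype.ext ?_
      have h3 := (Subtype.heq_iff_coe_eq (fun x => by rw [h1])).mp h2
      exact h3
  rw [Nat.card_sigma] at h1
  calc Nat.card S * c ≤ (∑ h, Nat.card (B h)) * c := Nat.mul_le_mul_right _ h1
    _ = ∑ h, Nat.card (B h) * c := Finset.sum_mul _ _ _
    _ ≤ ∑ _h : H, N := Finset.sum_le_sum fun h _ => hB h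
    _ = Nat.card H * N := by simp [Nat.card_eq_fintype_card]

theorem card_short_lists (m : ℕ) :
    Nat.card (Σ l : Fin (m + 1), List.Vector Bool l) ≤ 2 ^ (m + 1) := by
  rw [Nat.card_eq_fintype_card, Fintype.card_sigma]
  simp only [card_vector, Fintype.card_bool]
  rw [Fin.sum_univ_eq_sum_range (fun i => 2 ^ i), Nat.geomSum_eq le_rfl]
  simp

section Compression

variable {G : Dag} {κ ℓ : ℕ} {Out : Type}

namespace Dag

/-- The node `v` is computed in iteration `i + 1`. -/
def Computes (ζ : BitVec κ) (A : PromAlgorithm (OracleInput G κ ℓ) κ Out)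
    (ρ : Fin A.coins → Bool) (x : List Bool) (O : OracleInput G κ ℓ → BitVec κ) (i : ℕ)
    (v : G.V) : Prop :=
  G.point ζ O v ∈ A.asked O x ρ i

theorem exists_firstFits {Q : ℕ → List (OracleInput G κ ℓ)} {P : ℕ}
    (hQ : ∀ i, ∀ q ∈ Q i, i < P) (hlen : ∀ i, (Q i).length ≤ P) (t : ℕ)
    (p : OracleInput G κ ℓ) :
    ∃ f : Option (Fin P × Fin P), FirstFits Q t p (f.map fun a => (a.1.1, a.2.1)) := by
  classical
  by_cases hex : ∃ i, t ≤ i ∧ p ∈ Q i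
  · obtain ⟨h1, h2⟩ := Nat.find_spec hex
    obtain ⟨j, hj, hj'⟩ := List.mem_iff_getElem.mp h2
    refine ⟨some (⟨Nat.find hex, hQ _ _ h2⟩, ⟨j, hj.trans_le (hlen _)⟩), h1, ?_, ?_⟩
    · simp [List.getElem?_eq_getElem hj, hj']
    · exact fun i' h3 h4 h5 => Nat.find_min hex h4 ⟨h3, h5⟩
  · exact ⟨none, fun i hi hp => hex ⟨i, hi, hp⟩⟩

/-- The probability that the labels of many nodes can be predicted from a short state is small. -/
theorem card_predictable_mul_le (hℓ : ℓ ≤ κ) (ζ : BitVec κ)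
    (A : PromAlgorithm (OracleInput G κ ℓ) κ Out) (ρ : Fin A.coins → Bool)
    (R : (OracleInput G κ ℓ → BitVec κ) → List Bool) (P m k : ℕ)
    (hP : ∀ O, (A.run O (R O) ρ P).halted = true ∧ (A.run O (R O) ρ P).queries ≤ P)
    (outNeed : (OracleInput G κ ℓ → BitVec κ) → G.V → Prop)
    (hout : ∀ O O', R O = R O' → (∀ i, ∀ q ∈ A.asked O (R O) ρ i, O q = O' q) →
      (∀ x, O (.msg x) = O' (.msg x)) → ∀ v, outNeed O v → outNeed O' v →
      label G O ζ v = label G O' ζ v) :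
    Nat.card {O | ∃ t ≤ P, (A.run O (R O) ρ t).state.length ≤ m ∧
      k ≤ {v | Needed (Computes ζ A ρ (R O) O) t v ∨
        (t = 0 ∧ outNeed O v ∧ ∀ i, ¬ Computes ζ A ρ (R O) O i v)}.ncard} * 2 ^ (ℓ * k) ≤
      (P + 1) * (2 * (2 ^ (m + 1) *
        (Nat.card G.V * ((Nat.card G.V * (P * P) + 1) * (P * P + 1))) ^ k)) *
        Nat.card (OracleInput G κ ℓ → BitVec κ) := by
  classical
  have hfin : Finite (OracleInput G κ ℓ) := OracleInput.finite G κ ℓ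
  have hfb := BitVec.finite κ
  have hfV := G.finite
  let E := G.V × Option (G.V × Fin P × Fin P) × Option (Fin P × Fin P)
  -- A hint consists of the time, the halting flag, the state, and `k` nodes, each with pointers to
  -- a use of its label and to its first computation.
  let H := Fin (P + 1) × Bool × (Σ l : Fin (m + 1), List.Vector Bool l) × (Fin k → E)
  let nd : E → Option (G.V × ℕ × ℕ) := fun e => e.2.1.map fun a => (a.1, a.2.1.1, a.2.2.1)
  let fs : E → Option (ℕ × ℕ) := fun e => e.2.2.map fun a => (a.1.1, a.2.1)
  -- A label without a place of use has to come from the output. This is admitted only at time 0,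
  -- since a later state does not determine what was output earlier.
  let B : H → Set (OracleInput G κ ℓ → BitVec κ) := fun h =>
    {O | (A.run O (R O) ρ h.1.1).state = h.2.2.1.2.1 ∧ (A.run O (R O) ρ h.1.1).halted = h.2.1 ∧
      (Function.Injective fun a => (h.2.2.2 a).1) ∧ ∀ a,
        FirstFits (A.asked O (R O) ρ) h.1.1 (G.point ζ O (h.2.2.2 a).1) (fs (h.2.2.2 a)) ∧
        NeedFits G ζ O (A.asked O (R O) ρ) h.1.1 (h.2.2.2 a).1 (nd (h.2.2.2 a)) ∧
        (nd (h.2.2.2 a) = none → h.1.1 = 0 ∧ outNeed O (h.2.2.2 a).1)}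
  have hH : Nat.card H ≤ (P + 1) * (2 * (2 ^ (m + 1) *
        (Nat.card G.V * ((Nat.card G.V * (P * P) + 1) * (P * P + 1))) ^ k)) := by
    simp only [H, E, Nat.card_prod, Nat.card_fun, Nat.card_fin, Finite.card_option]
    rw [Nat.card_eq_fintype_card (α := Bool), Fintype.card_bool]
    gcongr
    exact card_short_lists m
  refine (Nat.card_mul_le_of_cover (B := B) (N := Nat.card (OracleInput G κ ℓ → BitVec κ))
    ?_ ?_).trans (Nat.mul_le_mul_right _ hH)
  · rintro O ⟨t, ht, hm, hk⟩
    obtain ⟨emb⟩ : Nonempty (Fin k ↪ {v | Needed (Computes ζ A ρ (R O) O) t v ∨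
        (t = 0 ∧ outNeed O v ∧ ∀ i, ¬ Computes ζ A ρ (R O) O i v)}) := by
      have := Fintype.ofFinite {v | Needed (Computes ζ A ρ (R O) O) t v ∨
        (t = 0 ∧ outNeed O v ∧ ∀ i, ¬ Computes ζ A ρ (R O) O i v)}
      refine Function.Embedding.nonempty_of_card_le ?_
      rw [Fintype.card_fin, ← Nat.card_eq_fintype_card]
      exact hk
    have hlt : ∀ i, ∀ q ∈ A.asked O (R O) ρ i, i < P := by
      intro i q hq
      by_contra hi
      have h1 := PromAlgorithm.not_halted_of_mem_asked hq
      rw [PromAlgorithm.run_of_halted (hP O).1 (not_lt.mp hi), (hP O).1] at h1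
      exact absurd h1 (by simp)
    have hlen := PromAlgorithm.length_asked_le (hP O).1 (hP O).2
    choose f hf using fun v : G.V => exists_firstFits hlt hlen t (G.point ζ O v)
    have hn : ∀ a, ∃ n : Option (G.V × Fin P × Fin P),
        NeedFits G ζ O (A.asked O (R O) ρ) t (emb a).1
          (n.map fun a => (a.1, a.2.1.1, a.2.2.1)) ∧
        ((n.map fun a => (a.1, a.2.1.1, a.2.2.1)) = none → t = 0 ∧ outNeed O (emb a).1) := by
      intro a
      rcases (emb a).2 with ⟨i, hi, u, hu, hc, hmin⟩ | ⟨ht0, ho, hnc⟩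
      · obtain ⟨j, hj, hj'⟩ := List.mem_iff_getElem.mp hc
        refine ⟨some (u, ⟨i, hlt _ _ hc⟩, ⟨j, hj.trans_le (hlen _)⟩), ⟨hi, hu, ?_, hmin⟩, ?_⟩
        · simp [List.getElem?_eq_getElem hj, hj']
        · simp
      · exact ⟨none, fun i _ => hnc i, fun _ => ⟨ht0, ho⟩⟩
    choose n hn using hn
    refine ⟨⟨⟨t, by omega⟩, (A.run O (R O) ρ t).halted,
      ⟨⟨(A.run O (R O) ρ t).state.length, by omega⟩, ⟨(A.run O (R O) ρ t).state, rfl⟩⟩,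
      fun a => ((emb a).1, n a, f (emb a).1)⟩, rfl, rfl, ?_, fun a => ⟨hf _, (hn a).1, (hn a).2⟩⟩
    exact fun a b hab => emb.injective (Subtype.ext hab)
  · intro h
    by_cases hinj : Function.Injective fun a => (h.2.2.2 a).1
    · have hag : ∀ O ∈ B h, ∀ O' ∈ B h, PromAlgorithm.Agree (A.run O (R O) ρ h.1.1)
          (A.run O' (R O') ρ h.1.1) := fun O hO O' hO' =>
        ⟨hO.1.trans hO'.1.symm, hO.2.1.trans hO'.2.1.symm⟩
      refine card_mul_two_pow_le (ζ := ζ) hℓ (B h) (fun O => A.asked O (R O) ρ) h.1.1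
        (fun a => (h.2.2.2 a).1) hinj (fun a => nd (h.2.2.2 a)) (fun a => fs (h.2.2.2 a))
        ?_ (fun O hO a => (hO.2.2.2 a).1) (fun O hO a => (hO.2.2.2 a).2.1) ?_
      · intro O hO O' hO' i hi hq
        exact PromAlgorithm.asked_eq_of_agree
          (PromAlgorithm.run_agree hi (hag O hO O' hO') hq).1
      · intro O hO O' hO' hq hmsg a ha
        obtain ⟨h0, h1⟩ := (hO.2.2.2 a).2.2 ha
        have h2 := ((hO'.2.2.2 a).2.2 ha).2
        refine hout O O' ?_ (fun i => hq i (by omega)) hmsg _ h1 h2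
        have := (hag O hO O' hO').1
        rw [h0] at this
        exact this
    · have : B h = ∅ := by
        ext O
        simp only [Set.mem_empty_iff_false, iff_false]
        exact fun hO => hinj hO.2.2.1
      rw [this]
      simp

end Dag

end Compression

/-! ### Sampling -/

theorem Nat.sum_digits_lt {ℓ q : ℕ} {a : ℕ → ℕ} (ha : ∀ m, a m < 2 ^ ℓ) :
    ∑ m ∈ Finset.range q, a m * 2 ^ (ℓ * m) < 2 ^ (ℓ * q) := by
  induction q with
  | zero => simp
  | succ q ih =>
    rw [Finset.sum_range_succ]
    have h1 : (a q + 1) * 2 ^ (ℓ * q) ≤ 2 ^ ℓ * 2 ^ (ℓ * q) :=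
      Nat.mul_le_mul_right _ (ha q)
    rw [← pow_add, show ℓ + ℓ * q = ℓ * (q + 1) by ring] at h1
    linarith

theorem Nat.digits_eq_of_sum_eq {ℓ q : ℕ} {a b : ℕ → ℕ} (ha : ∀ m, a m < 2 ^ ℓ)
    (hb : ∀ m, b m < 2 ^ ℓ)
    (h : ∑ m ∈ Finset.range q, a m * 2 ^ (ℓ * m) = ∑ m ∈ Finset.range q, b m * 2 ^ (ℓ * m)) :
    ∀ m < q, a m = b m := by
  induction q with
  | zero => intro m hm; omega
  | succ q ih =>
    rw [Finset.sum_range_succ, Finset.sum_range_succ] at h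
    have h1 := Nat.sum_digits_lt (q := q) ha
    have h2 := Nat.sum_digits_lt (q := q) hb
    have hpos : 0 < 2 ^ (ℓ * q) := by positivity
    have hq : a q = b q := by
      have e := congrArg (· / 2 ^ (ℓ * q)) h
      simpa [Nat.add_mul_div_right _ _ hpos, Nat.div_eq_of_lt h1, Nat.div_eq_of_lt h2] using e
    rw [hq] at h
    intro m hm
    rcases Nat.lt_succ_iff_lt_or_eq.mp hm with h3 | rfl
    · exact ih (Nat.add_right_cancel h) m h3
    · exact hq

/-- Since `N ≤ 2 ^ ℓ`, a residue has at most `2 ^ ℓ / N + 1 ≤ 2 * (2 ^ ℓ / N)` representatives. This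
factor two turns a quarter of the residues into at most half of the blocks. -/
theorem card_residues_mul_two_le {ℓ N : ℕ} (W : Finset ℕ) (hW : 4 * W.card ≤ N) (hN : 0 < N)
    (hNℓ : N ≤ 2 ^ ℓ) : Nat.card {b : BitVec ℓ | b.toNat % N ∈ W} * 2 ≤ 2 ^ ℓ := by
  have h1 : Nat.card {b : BitVec ℓ | b.toNat % N ∈ W} ≤ Nat.card (W × Fin (2 ^ ℓ / N + 1)) := by
    refine Nat.card_le_card_of_injective (fun b => (⟨b.1.toNat % N, b.2⟩,
      ⟨b.1.toNat / N, Nat.lt_succ_of_le (Nat.div_le_div_right b.1.isLt.le)⟩)) ?_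
    intro a b h
    simp only [Prod.mk.injEq, Subtype.mk.injEq, Fin.mk.injEq] at h
    refine Subtype.ext (BitVec.eq_of_toNat_eq ?_)
    rw [← Nat.div_add_mod a.1.toNat N, ← Nat.div_add_mod b.1.toNat N, h.1, h.2]
  rw [Nat.card_prod, Nat.card_fin, Nat.card_eq_fintype_card (α := W), Fintype.card_coe] at h1
  have h2 : 1 ≤ 2 ^ ℓ / N := Nat.div_pos hNℓ hN
  have h3 : N * (2 ^ ℓ / N) ≤ 2 ^ ℓ := Nat.mul_div_le _ _
  nlinarith [Nat.mul_le_mul_right (2 ^ ℓ / N) hW, Nat.mul_le_mul_left W.card h2]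

/-- The blocks occupy disjoint ranges of bits and are therefore independent. -/
theorem card_blocks_mul_le {κ ℓ q : ℕ} (hq : q * ℓ ≤ κ) (W : Set (BitVec ℓ))
    (hW : Nat.card W * 2 ≤ 2 ^ ℓ) :
    Nat.card {b : BitVec κ | ∀ m < q, b.extractLsb' (m * ℓ) ℓ ∈ W} * 2 ^ q ≤ 2 ^ κ := by
  have := BitVec.finite
  have h1 : Nat.card {b : BitVec κ | ∀ m < q, b.extractLsb' (m * ℓ) ℓ ∈ W} ≤
      Nat.card ((Fin q → W) × BitVec (κ - q * ℓ)) := by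
    refine Nat.card_le_card_of_injective (fun b =>
      (fun m => ⟨b.1.extractLsb' (m.1 * ℓ) ℓ, b.2 m.1 m.2⟩, b.1.extractLsb' (q * ℓ) _)) ?_
    rintro ⟨a, ha⟩ ⟨b, hb⟩ h
    simp only [Prod.mk.injEq] at h
    refine Subtype.ext (BitVec.eq_of_getLsbD_eq fun i hi => ?_)
    by_cases hiq : i < q * ℓ
    · have hℓ : 0 < ℓ := Nat.pos_of_ne_zero fun h0 => by simp [h0] at hiq
      have hm : i / ℓ < q := Nat.div_lt_of_lt_mul (by rwa [mul_comm] at hiq)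
      have e := congrArg (fun x => x.getLsbD (i % ℓ))
        (congrArg Subtype.val (congrFun h.1 ⟨i / ℓ, hm⟩))
      have hi' : i / ℓ * ℓ + i % ℓ = i := Nat.div_add_mod' i ℓ
      simpa [BitVec.getLsbD_extractLsb', Nat.mod_lt _ hℓ, hi'] using e
    · have e := congrArg (fun x => x.getLsbD (i - q * ℓ)) h.2
      have h2 : i - q * ℓ < κ - q * ℓ := by omega
      have h3 : q * ℓ + (i - q * ℓ) = i := by omega
      simpa [BitVec.getLsbD_extractLsb', h2, h3] using e
  rw [Nat.card_prod, Nat.card_fun, Nat.card_fin, Nat.card_bitVec] at h1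
  calc _ ≤ (Nat.card W ^ q * 2 ^ (κ - q * ℓ)) * 2 ^ q := Nat.mul_le_mul_right _ h1
    _ = (Nat.card W * 2) ^ q * 2 ^ (κ - q * ℓ) := by rw [mul_pow]; ring
    _ ≤ (2 ^ ℓ) ^ q * 2 ^ (κ - q * ℓ) := by gcongr
    _ = 2 ^ κ := by rw [← pow_mul, ← pow_add]; congr 1; rw [mul_comm ℓ q]; omega

theorem card_functions_mul_le {α β : Type} [Finite α] [Finite β] (Y : Finset α) (W : Set β)
    {c : ℕ} (hW : Nat.card W * c ≤ Nat.card β) :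
    Nat.card {f : α → β | ∀ y ∈ Y, f y ∈ W} * c ^ Y.card ≤ Nat.card (α → β) := by
  classical
  have := Fintype.ofFinite α
  have := Fintype.ofFinite β
  have h1 : Nat.card {f : α → β | ∀ y ∈ Y, f y ∈ W} =
      ∏ y : α, if y ∈ Y then Nat.card W else Nat.card β := by
    have : {f : α → β | ∀ y ∈ Y, f y ∈ W} =
        (Fintype.piFinset fun y => if y ∈ Y then W.toFinset else Finset.univ : Finset (α → β)) := by
      ext f
      simp only [Set.mem_ofPred_eq, Finset.mem_coe, Fintype.mem_piFinset]
      refine forall_congr' fun y => ?_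
      split_ifs with h <;> simp [h]
    rw [this, Nat.card_eq_fintype_card]
    simp only [Finset.coe_sort_coe, Fintype.card_coe, Fintype.card_piFinset]
    refine Finset.prod_congr rfl fun y _ => ?_
    split_ifs <;> simp [Nat.card_eq_fintype_card, Set.toFinset_card]
  have h2 : c ^ Y.card = ∏ y : α, if y ∈ Y then c else 1 := by
    rw [Finset.prod_ite_mem, Finset.univ_inter, Finset.prod_const]
  rw [h1, h2, ← Finset.prod_mul_distrib, Nat.card_fun, Nat.card_eq_fintype_card (α := α)]
  calc _ ≤ ∏ _y : α, Nat.card β := Finset.prod_le_prod' fun y _ => by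
        split_ifs
        · exact hW
        · simp
    _ = _ := by simp

section Sampling

variable {G : Dag} {κ ℓ : ℕ}

/-- The positions that are sampled by the second algorithm on the inputs in `X`. -/
def samples (O : OracleInput G κ ℓ → BitVec κ) (N q' : ℕ) (X : Finset (BitVec κ)) : Finset ℕ :=
  (X ×ˢ Finset.range q').image fun p => ((O (.msg p.1)).extractLsb' (p.2 * ℓ) ℓ).toNat % N

theorem mem_samples {O : OracleInput G κ ℓ → BitVec κ} {N q' : ℕ} {X : Finset (BitVec κ)} {i : ℕ} :
    i ∈ samples O N q' X ↔
      ∃ x ∈ X, ∃ m < q', ((O (.msg x)).extractLsb' (m * ℓ) ℓ).toNat % N = i := by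
  simp [samples, and_assoc]

/-- It is unlikely that few positions are sampled. -/
theorem card_few_samples_mul_le {N k q' : ℕ} (hN : 0 < N) (hk : 4 * k ≤ N) (hNℓ : N ≤ 2 ^ ℓ)
    (hq : q' * ℓ ≤ κ) (X : Finset (BitVec κ)) :
    Nat.card {O : OracleInput G κ ℓ → BitVec κ | (samples O N q' X).card ≤ k} *
      2 ^ (q' * X.card) ≤ N ^ k * Nat.card (OracleInput G κ ℓ → BitVec κ) := by
  classical
  have hfin : Finite (OracleInput G κ ℓ) := OracleInput.finite G κ ℓ
  have := BitVec.finite κ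
  have hsub : ∀ O : OracleInput G κ ℓ → BitVec κ, samples O N q' X ⊆ Finset.range N := by
    intro O i hi
    obtain ⟨x, -, m, -, rfl⟩ := mem_samples.mp hi
    exact Finset.mem_range.mpr (Nat.mod_lt _ hN)
  refine (Nat.card_mul_le_of_cover (H := (Finset.range N).powersetCard k)
    (B := fun W => {O | ∀ y ∈ X.image OracleInput.msg, O y ∈
      {b : BitVec κ | ∀ m < q', b.extractLsb' (m * ℓ) ℓ ∈
        {b : BitVec ℓ | b.toNat % N ∈ W.1}}}) ?_ ?_).trans
    (Nat.mul_le_mul_right _ ?_)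
  · intro O hO
    -- Enlarging the sampled set to exactly `k` positions leaves at most `N ^ k` sets for the union
    -- bound.
    obtain ⟨W, h1, h2, h3⟩ := Finset.exists_subsuperset_card_eq (hsub O) hO
      (by rw [Finset.card_range]; omega)
    refine ⟨⟨W, Finset.mem_powersetCard.mpr ⟨h2, h3⟩⟩, ?_⟩
    intro y hy m hm
    obtain ⟨x, hx, rfl⟩ := Finset.mem_image.mp hy
    exact h1 (mem_samples.mpr ⟨x, hx, m, hm, rfl⟩)
  · rintro ⟨W, hW⟩
    obtain ⟨-, hWk⟩ := Finset.mem_powersetCard.mp hW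
    have h1 := card_residues_mul_two_le W (by omega) hN hNℓ
    have h2 := card_blocks_mul_le hq _ h1
    rw [← Nat.card_bitVec κ] at h2
    have h3 := card_functions_mul_le
      (X.image (OracleInput.msg : BitVec κ → OracleInput G κ ℓ)) _ h2
    rwa [Finset.card_image_of_injective _ fun a b h => by injection h, ← pow_mul] at h3
  · rw [Nat.card_eq_fintype_card, Fintype.card_coe, Finset.card_powersetCard, Finset.card_range]
    exact Nat.choose_le_pow _ _

/-- The sampled words can be read off from the value of the hash function. -/
theorem seek_eq_of_hashTwo_eq {q' N : ℕ} (hq : q' * ℓ ≤ κ) {O O' : OracleInput G κ ℓ → BitVec κ}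
    (hO : ∀ x, O (.msg x) = O' (.msg x)) {f f' : ℕ → BitVec ℓ} {x : BitVec κ}
    (h : hashTwo G κ ℓ q' O N f x = hashTwo G κ ℓ q' O' N f' x) {m : ℕ} (hm : m < q') :
    f (((O (.msg x)).extractLsb' (m * ℓ) ℓ).toNat % N) =
      f' (((O (.msg x)).extractLsb' (m * ℓ) ℓ).toNat % N) := by
  simp only [hashTwo, ← hO, BitVec.xor_left_inj] at h
  have h1 := congrArg BitVec.toNat h
  have hle : 2 ^ (ℓ * q') ≤ 2 ^ κ := Nat.pow_le_pow_right (by norm_num) (by rwa [mul_comm])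
  rw [BitVec.toNat_ofNat, BitVec.toNat_ofNat,
    Nat.mod_eq_of_lt ((Nat.sum_digits_lt fun m => BitVec.isLt _).trans_le hle),
    Nat.mod_eq_of_lt ((Nat.sum_digits_lt fun m => BitVec.isLt _).trans_le hle)] at h1
  exact BitVec.eq_of_toNat_eq
    (Nat.digits_eq_of_sum_eq (fun m => BitVec.isLt _) (fun m => BitVec.isLt _) h1 m hm)

end Sampling

/-! ### The success probability for a fixed security parameter -/

theorem unifProb_prod_le {Ω C : Type} [Finite Ω] [Finite C] (E : Set (Ω × C)) {δ : ℝ} (hδ : 0 ≤ δ)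
    (h : ∀ c, (Nat.card {ω | (ω, c) ∈ E} : ℝ) ≤ δ * Nat.card Ω) : unifProb E ≤ δ := by
  classical
  have := Fintype.ofFinite C
  have h1 : Nat.card E = ∑ c, Nat.card {ω | (ω, c) ∈ E} := by
    rw [← Nat.card_sigma]
    exact Nat.card_congr
      { toFun := fun p => ⟨p.1.2, p.1.1, p.2⟩
        invFun := fun p => ⟨(p.2.1, p.1), p.2.2⟩
        left_inv := fun _ => rfl
        right_inv := fun _ => rfl }
  refine div_le_of_le_mul₀ (Nat.cast_nonneg _) hδ ?_
  rw [h1, Nat.card_prod, Nat.card_eq_fintype_card (α := C)]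
  push_cast
  calc ∑ c, (Nat.card {ω | (ω, c) ∈ E} : ℝ) ≤ ∑ _c : C, δ * (Nat.card Ω : ℝ) :=
        Finset.sum_le_sum fun c _ => h c
    _ = _ := by simp; ring

section Fixed

variable {s c₁ κ ℓ : ℕ} {root : ℕ → ℕ}

/-- The number of words of the static string. -/
noncomputable def sinkCount (G : Dag) : ℕ := Nat.card {v : G.V // G.IsSink v}

/-- The hash function with words of `ℓ` bits. -/
noncomputable def sinkHash (G : Dag) (ℓ q' : ℕ) (ζ : BitVec κ) (O : OracleInput G κ ℓ → BitVec κ)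
    (x : BitVec κ) : BitVec κ :=
  hashTwo G κ ℓ q' O (sinkLabels G O ζ).length (fun ι => (sinkLabels G O ζ).getD ι 0) x

/-- The sink number `i`. -/
noncomputable def sink (G : Dag) (i : Fin (sinkCount G)) : G.V :=
  haveI := G.finite
  ((Finite.equivFin {v : G.V // G.IsSink v}).symm i).1

theorem isSink_sink (G : Dag) (i : Fin (sinkCount G)) : G.IsSink (sink G i) :=
  haveI := G.finite
  ((Finite.equivFin {v : G.V // G.IsSink v}).symm i).2

theorem sink_injective (G : Dag) : Function.Injective (sink G) := by
  have := G.finite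
  exact Subtype.val_injective.comp (Finite.equivFin {v : G.V // G.IsSink v}).symm.injective

theorem length_sinkLabels (G : Dag) (ζ : BitVec κ) (O : OracleInput G κ ℓ → BitVec κ) :
    (sinkLabels G O ζ).length = sinkCount G := by
  simp [sinkLabels, sinkCount]

theorem getD_sinkLabels (G : Dag) (ζ : BitVec κ) (O : OracleInput G κ ℓ → BitVec κ)
    (i : Fin (sinkCount G)) : (sinkLabels G O ζ).getD i 0 = label G O ζ (sink G i) := by
  have hi : i.1 < Nat.card {v : G.V // G.IsSink v} := i.2
  simp only [sinkLabels, sink, List.getD_eq_getElem?_getD, List.getElem?_ofFn, hi, dif_pos,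
    Option.getD_some]
  rfl

/-- The targets whose labels are needed for the output. -/
def OutputNeeds (G : Dag) (ℓ q' : ℕ) (ζ : BitVec κ)
    (A : PromAlgorithm (OracleInput G κ ℓ) κ (BitVec κ × BitVec κ))
    (ρ : Fin A.coins → Bool) (R : (OracleInput G κ ℓ → BitVec κ) → List Bool)
    (X : Finset (BitVec κ)) (O : OracleInput G κ ℓ → BitVec κ) (v : G.V) : Prop :=
  A.Outputs O (R O) ρ {y | ∃ x ∈ X, y = (x, sinkHash G ℓ q' ζ O x)} ∧
    ∃ i : Fin (sinkCount G), i.1 ∈ samples O (sinkCount G) q' X ∧ v = sink G i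

/-- Equal inputs and answers produce equal outputs. The mask and the sampled positions are answers
to message queries, so the hash values reveal the sampled words. -/
theorem outputNeeds_label_eq {G : Dag} {q' : ℕ} (hq : q' * ℓ ≤ κ) {ζ : BitVec κ}
    {A : PromAlgorithm (OracleInput G κ ℓ) κ (BitVec κ × BitVec κ)}
    {ρ : Fin A.coins → Bool} {R : (OracleInput G κ ℓ → BitVec κ) → List Bool}
    {X : Finset (BitVec κ)} {O O' : OracleInput G κ ℓ → BitVec κ} (hR : R O = R O')
    (hrun : ∀ i, ∀ q ∈ A.asked O (R O) ρ i, O q = O' q)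
    (hmsg : ∀ x, O (.msg x) = O' (.msg x)) {v : G.V}
    (h : OutputNeeds G ℓ q' ζ A ρ R X O v) (h' : OutputNeeds G ℓ q' ζ A ρ R X O' v) :
    label G O ζ v = label G O' ζ v := by
  obtain ⟨⟨t, ht, ho⟩, i, hi, rfl⟩ := h
  obtain ⟨⟨t', ht', ho'⟩, -⟩ := h'
  have hout := (PromAlgorithm.run_agree (Nat.zero_le (max t t'))
    (show PromAlgorithm.Agree (A.run O (R O) ρ 0) (A.run O' (R O') ρ 0) from ⟨hR, rfl⟩)
    fun j _ _ => hrun j).2 rfl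
  rw [PromAlgorithm.run_of_halted ht (le_max_left _ _),
    PromAlgorithm.run_of_halted ht' (le_max_right _ _)] at hout
  rw [hout, ho'] at ho
  obtain ⟨x, hx, m, hm, hxm⟩ := mem_samples.mp hi
  have hmem : (x, sinkHash G ℓ q' ζ O x) ∈
      {y | ∃ x ∈ X, y = (x, sinkHash G ℓ q' ζ O' x)} := by
    rw [ho]; exact ⟨x, hx, rfl⟩
  obtain ⟨x', -, hxx⟩ := hmem
  obtain ⟨rfl, hh⟩ := Prod.mk.inj hxx
  rw [sinkHash, sinkHash, length_sinkLabels, length_sinkLabels] at hh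
  have := seek_eq_of_hashTwo_eq hq hmsg hh hm
  rwa [hxm, getD_sinkLabels, getD_sinkLabels] at this

/-- Each sampled target has in its own copy a node predictable at time 0: the target itself if it is
never computed, and a needed node otherwise. Two parameters occur because `k` measures the
information in a state, while `h` sets the length `2 * h * h` of the pebbling argument, which must
be of order `n` even if `k` is small. -/
theorem predictable_or_few_samples {h k m P q' : ℕ} (hs : 2 ≤ s) (hc₁ : 1 ≤ c₁)
    (hroot : ∀ i, 2 ≤ i → i ≤ s → PNode.IsCell s i (root i)) (h8 : 8 * h ≤ s) (hk : 0 < k)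
    (hkh : k ≤ h) {ζ : BitVec κ}
    {A : PromAlgorithm (OracleInput (hardGraph s c₁ root) κ ℓ) κ (BitVec κ × BitVec κ)}
    {ρ : Fin A.coins → Bool} {R : (OracleInput (hardGraph s c₁ root) κ ℓ → BitVec κ) → List Bool}
    {X : Finset (BitVec κ)} {O : OracleInput (hardGraph s c₁ root) κ ℓ → BitVec κ} {L τ : ℝ}
    (hP : (A.run O (R O) ρ P).halted = true) (hRL : ((R O).length : ℝ) < L) (hL : L ≤ m + 1)
    (hτ : τ ≤ 2 * h * h)
    (hout : A.Outputs O (R O) ρ {y | ∃ x ∈ X, y = (x, sinkHash (hardGraph s c₁ root) ℓ q' ζ O x)})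
    (hsus : (A.sustainedMem O (R O) ρ L : ℝ) < τ) :
    (∃ t ≤ P, (A.run O (R O) ρ t).state.length ≤ m ∧
      k ≤ {v | Dag.Needed (Dag.Computes ζ A ρ (R O) O) t v ∨
        (t = 0 ∧ OutputNeeds (hardGraph s c₁ root) ℓ q' ζ A ρ R X O v ∧
          ∀ i, ¬ Dag.Computes ζ A ρ (R O) O i v)}.ncard) ∨
      (samples O (sinkCount (hardGraph s c₁ root)) q' X).card < k := by
  by_contra hcon
  obtain ⟨hbad, hfew⟩ := not_or.mp hcon
  have hfin := (hardGraph s c₁ root).finite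
  have hneed : ∀ t ≤ P, ((A.run O (R O) ρ t).state.length : ℝ) < L →
      {v | Dag.Needed (Dag.Computes ζ A ρ (R O) O) t v ∨
        (t = 0 ∧ OutputNeeds (hardGraph s c₁ root) ℓ q' ζ A ρ R X O v ∧
          ∀ i, ¬ Dag.Computes ζ A ρ (R O) O i v)}.ncard < k := by
    intro t ht hlt
    by_contra hge
    refine hbad ⟨t, ht, ?_, not_lt.mp hge⟩
    have : ((A.run O (R O) ρ t).state.length : ℝ) < (m + 1 : ℕ) := by
      push_cast; linarith
    exact Nat.lt_succ_iff.mp (Nat.cast_lt.mp this)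
  have hsmall : ∀ t, ((A.run O (R O) ρ t).state.length : ℝ) < L →
      {v | Dag.Needed (Dag.Computes ζ A ρ (R O) O) t v}.ncard < h := by
    intro t hlt
    by_cases ht : t ≤ P
    · refine lt_of_le_of_lt (Set.ncard_le_ncard ?_ (Set.toFinite _))
        ((hneed t ht hlt).trans_le hkh)
      exact fun v hv => Or.inl hv
    · have : {v | Dag.Needed (Dag.Computes ζ A ρ (R O) O) t v} = ∅ := by
        ext v
        simp only [Set.mem_ofPred_eq, Set.mem_empty_iff_false, iff_false]
        rintro ⟨i, hi, u, -, hc, -⟩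
        have h1 := PromAlgorithm.not_halted_of_le (show P ≤ i by omega)
          (PromAlgorithm.not_halted_of_mem_asked hc)
        rw [hP] at h1
        exact absurd h1 (by simp)
      rw [this, Set.ncard_empty]
      omega
  -- All iterations of a period without small states count towards the sustained memory.
  have hrun : ∀ t₀ t, t₀ ≤ t → (A.run O (R O) ρ t).halted = false →
      (∀ j, t₀ < j → j ≤ t → ¬ ((A.run O (R O) ρ j).state.length : ℝ) < L) →
      t < t₀ + 2 * h * h := by
    intro t₀ t h1 h2 h3
    have hfinS : {i : ℕ | (∀ j < i, (A.run O (R O) ρ j).halted = false) ∧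
        L ≤ ((A.run O (R O) ρ i).state.length : ℝ)}.Finite := by
      refine (Set.finite_Iic P).subset fun i hi => ?_
      by_contra hPi
      have := hi.1 P (not_le.mp hPi)
      rw [hP] at this
      exact absurd this (by simp)
    have hsub : (Set.Ioc t₀ t) ⊆ {i : ℕ | (∀ j < i, (A.run O (R O) ρ j).halted = false) ∧
        L ≤ ((A.run O (R O) ρ i).state.length : ℝ)} := fun i hi =>
      ⟨fun j hj => PromAlgorithm.not_halted_of_le (hj.le.trans hi.2) h2,
        not_lt.mp (h3 i hi.1 hi.2)⟩
    have hle := Set.ncard_le_ncard hsub hfinS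
    rw [Set.ncard_eq_toFinset_card', Set.toFinset_Ioc, Nat.card_Ioc] at hle
    have : ((t - t₀ : ℕ) : ℝ) < ((2 * h * h : ℕ) : ℝ) := by
      push_cast
      calc ((t - t₀ : ℕ) : ℝ) ≤ (A.sustainedMem O (R O) ρ L : ℝ) := by exact_mod_cast hle
        _ < 2 * h * h := by linarith
    have := Nat.cast_lt.mp this
    omega
  have hsink : ∀ i : Fin (sinkCount (hardGraph s c₁ root)),
      HardGraph.name (sink _ i) = PNode.w (s - 1) := fun i =>
    (HardGraph.isSink_iff hs hc₁ hroot _).mp (isSink_sink _ i)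
  have hN : 0 < sinkCount (hardGraph s c₁ root) := by
    rw [sinkCount, HardGraph.card_sinks hs hc₁ hroot]; omega
  have hlt : ∀ i ∈ samples O (sinkCount (hardGraph s c₁ root)) q' X,
      i < sinkCount (hardGraph s c₁ root) := by
    intro i hi
    obtain ⟨x, -, m, -, rfl⟩ := mem_samples.mp hi
    exact Nat.mod_lt _ hN
  have hex : ∀ i : samples O (sinkCount (hardGraph s c₁ root)) q' X, ∃ y,
      (Dag.Needed (Dag.Computes ζ A ρ (R O) O) 0 y ∨
        (0 = 0 ∧ OutputNeeds (hardGraph s c₁ root) ℓ q' ζ A ρ R X O y ∧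
          ∀ i, ¬ Dag.Computes ζ A ρ (R O) O i y)) ∧
      HardGraph.copy y = HardGraph.copy (sink _ ⟨i.1, hlt i.1 i.2⟩) := by
    intro i
    by_cases hc : ∃ t, Dag.Computes ζ A ρ (R O) O t (sink _ ⟨i.1, hlt i.1 i.2⟩)
    · obtain ⟨t, hc⟩ := hc
      obtain ⟨y, h1, h2⟩ := HardGraph.exists_needed_of_comp_sink h8 hroot
        (Dag.Computes ζ A ρ (R O) O) (fun t => (A.run O (R O) ρ t).halted = false)
        (fun t => ((A.run O (R O) ρ t).state.length : ℝ) < L)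
        (fun t => PromAlgorithm.not_halted_of_le (Nat.le_succ t))
        (fun t y => PromAlgorithm.not_halted_of_mem_asked) hRL hsmall hrun (hsink _) hc
      exact ⟨y, Or.inl h1, h2⟩
    · exact ⟨_, Or.inr ⟨rfl, ⟨hout, _, i.2, rfl⟩, fun t ht => hc ⟨t, ht⟩⟩, rfl⟩
  choose f hf1 hf2 using hex
  refine hfew (lt_of_le_of_lt ?_ (hneed 0 (Nat.zero_le _) hRL))
  have hinj := Nat.card_le_card_of_injective (fun i => (⟨f i, hf1 i⟩ :
    {v | Dag.Needed (Dag.Computes ζ A ρ (R O) O) 0 v ∨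
        (0 = 0 ∧ OutputNeeds (hardGraph s c₁ root) ℓ q' ζ A ρ R X O v ∧
          ∀ i, ¬ Dag.Computes ζ A ρ (R O) O i v)})) fun i j hij => by
    have h1 : f i = f j := congrArg Subtype.val hij
    have h2 := (hf2 i).symm.trans ((congrArg _ h1).trans (hf2 j))
    have h3 := sink_injective _ (HardGraph.ext_of_name_copy ((hsink _).trans (hsink _).symm) h2)
    exact Subtype.ext (congrArg Fin.val h3)
  rw [Nat.card_eq_fintype_card, Fintype.card_coe] at hinj
  exact hinj

/-- The success probability for a fixed security parameter. -/
theorem unifProb_success_le {h k m P q' : ℕ} (hs : 2 ≤ s) (hc₁ : 1 ≤ c₁)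
    (hroot : ∀ i, 2 ≤ i → i ≤ s → PNode.IsCell s i (root i)) (h8 : 8 * h ≤ s) (hk : 0 < k)
    (hkh : k ≤ h) (hℓ : ℓ ≤ κ) (hq : q' * ℓ ≤ κ) (ζ : BitVec κ)
    (A : PromAlgorithm (OracleInput (hardGraph s c₁ root) κ ℓ) κ (BitVec κ × BitVec κ))
    (R : (OracleInput (hardGraph s c₁ root) κ ℓ → BitVec κ) → List Bool)
    (X : Finset (BitVec κ)) {L τ δ : ℝ}
    (hP : ∀ O ρ, (A.run O (R O) ρ P).halted = true ∧ (A.run O (R O) ρ P).queries ≤ P)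
    (hRL : ∀ O, ((R O).length : ℝ) < L) (hL : L ≤ m + 1) (hτ : τ ≤ 2 * h * h) (hδ : 0 ≤ δ)
    (hfew : (Nat.card {O : OracleInput (hardGraph s c₁ root) κ ℓ → BitVec κ |
      (samples O (sinkCount (hardGraph s c₁ root)) q' X).card < k} : ℝ) ≤
        δ * Nat.card (OracleInput (hardGraph s c₁ root) κ ℓ → BitVec κ)) :
    unifProb {ω : (OracleInput (hardGraph s c₁ root) κ ℓ → BitVec κ) × (Fin A.coins → Bool) |
      A.Outputs ω.1 (R ω.1) ω.2
        {y | ∃ x ∈ X, y = (x, sinkHash (hardGraph s c₁ root) ℓ q' ζ ω.1 x)} ∧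
      (A.sustainedMem ω.1 (R ω.1) ω.2 L : ℝ) < τ} ≤
      ((P + 1) * (2 * (2 ^ (m + 1) * (Nat.card (hardGraph s c₁ root).V *
        ((Nat.card (hardGraph s c₁ root).V * (P * P) + 1) * (P * P + 1))) ^ k)) : ℕ) /
        2 ^ (ℓ * k) + δ := by
  have hfin : Finite (OracleInput (hardGraph s c₁ root) κ ℓ) := OracleInput.finite _ κ ℓ
  have := BitVec.finite κ
  refine unifProb_prod_le _ (by positivity) fun ρ => ?_
  have h1 := Dag.card_predictable_mul_le hℓ ζ A ρ R P m k (fun O => hP O ρ)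
    (OutputNeeds (hardGraph s c₁ root) ℓ q' ζ A ρ R X) fun O O' hR hrun hmsg v =>
      outputNeeds_label_eq hq hR hrun hmsg
  have hsub := fun O (hO : O ∈ {O | (O, ρ) ∈ {ω : (OracleInput (hardGraph s c₁ root) κ ℓ →
      BitVec κ) × (Fin A.coins → Bool) | A.Outputs ω.1 (R ω.1) ω.2
        {y | ∃ x ∈ X, y = (x, sinkHash (hardGraph s c₁ root) ℓ q' ζ ω.1 x)} ∧
      (A.sustainedMem ω.1 (R ω.1) ω.2 L : ℝ) < τ}}) =>
    predictable_or_few_samples hs hc₁ hroot h8 hk hkh (hP O ρ).1 (hRL O) hL hτ hO.1 hO.2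
  have h2 := (Set.ncard_le_ncard (t := {O | _} ∪ {O | _}) hsub (Set.toFinite _)).trans
    (Set.ncard_union_le _ _)
  rw [add_mul]
  refine le_trans (b := ((_ + _ : ℕ) : ℝ)) (Nat.cast_le.mpr h2) ?_
  rw [Nat.cast_add]
  refine add_le_add ?_ hfew
  rw [div_mul_eq_mul_div, le_div_iff₀ (by positivity)]
  exact_mod_cast h1

end Fixed

/-! ### Asymptotics -/

open Filter Asymptotics

theorem superpolynomialDecay_of_le {f : ℕ → ℝ} (h0 : ∀ κ, 0 ≤ f κ)
    (h : ∀ b : ℕ, ∀ᶠ κ : ℕ in atTop, (κ : ℝ) ^ b * f κ ≤ 1) :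
    SuperpolynomialDecay atTop (fun κ : ℕ => (κ : ℝ)) f := by
  intro n
  refine squeeze_zero' (Eventually.of_forall fun κ => mul_nonneg (by positivity) (h0 κ)) ?_
    (tendsto_inv_atTop_zero.comp tendsto_natCast_atTop_atTop)
  filter_upwards [h (n + 1), eventually_gt_atTop 0] with κ h1 h2
  have h2' : (0 : ℝ) < κ := by exact_mod_cast h2
  simp only [Function.comp]
  rw [← one_div, le_div_iff₀ h2']
  calc _ = (κ : ℝ) ^ (n + 1) * f κ := by ring
    _ ≤ 1 := h1

theorem Polynomial.exists_eval_le_pow (p : Polynomial ℕ) :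
    ∃ d : ℕ, ∀ x : ℕ, 2 ≤ x → p.eval x ≤ x ^ d := by
  refine ⟨p.eval 1 + p.natDegree, fun x hx => ?_⟩
  rw [Polynomial.eval_eq_sum_range, pow_add]
  have h1 : p.eval 1 ≤ x ^ p.eval 1 := (Nat.lt_pow_self (by omega)).le
  calc ∑ i ∈ Finset.range (p.natDegree + 1), p.coeff i * x ^ i
      ≤ ∑ i ∈ Finset.range (p.natDegree + 1), p.coeff i * x ^ p.natDegree := by
        refine Finset.sum_le_sum fun i hi => Nat.mul_le_mul_left _ ?_
        exact Nat.pow_le_pow_right (by omega) (by rw [Finset.mem_range] at hi; omega)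
    _ = p.eval 1 * x ^ p.natDegree := by
        rw [← Finset.sum_mul, Polynomial.eval_eq_sum_range]; simp
    _ ≤ _ := Nat.mul_le_mul_right _ h1

theorem Polynomial.eval_mono_nat (p : Polynomial ℕ) {x y : ℕ} (h : x ≤ y) : p.eval x ≤ p.eval y := by
  rw [Polynomial.eval_eq_sum_range, Polynomial.eval_eq_sum_range]
  gcongr

theorem eventually_pow_le_two_rpow {f : ℕ → ℝ}
    (hf : (fun κ : ℕ => Real.log κ) =o[atTop] f) (e : ℕ) (hf0 : ∀ᶠ κ in atTop, 0 ≤ f κ) :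
    ∀ᶠ κ : ℕ in atTop, (κ : ℝ) ^ e ≤ 2 ^ f κ := by
  have hlog2 : 0 < Real.log 2 := Real.log_pos (by norm_num)
  filter_upwards [hf.def (show 0 < Real.log 2 / (e + 1) by positivity), hf0,
    eventually_gt_atTop 0] with κ h1 h2 h3
  have h3' : (0 : ℝ) < κ := by exact_mod_cast h3
  have h4 : 0 ≤ Real.log κ := Real.log_natCast_nonneg _
  rw [Real.norm_of_nonneg h4, Real.norm_of_nonneg h2, div_mul_eq_mul_div,
    le_div_iff₀ (by positivity)] at h1
  rw [← Real.log_le_log_iff (by positivity) (by positivity), Real.log_pow,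
    Real.log_rpow (by norm_num)]
  nlinarith

/-- The words are long. -/
theorem isLittleO_log_word {q' : ℕ → ℕ}
    (h : (fun κ : ℕ => Real.log κ) =o[atTop] fun κ : ℕ => (κ : ℝ) / (q' κ : ℝ)) :
    (fun κ : ℕ => Real.log κ) =o[atTop] fun κ : ℕ => ((κ / q' κ : ℕ) : ℝ) := by
  refine h.trans_isBigO (IsBigO.of_bound 2 ?_)
  filter_upwards [h.def one_pos, (Real.tendsto_log_atTop.comp
    tendsto_natCast_atTop_atTop).eventually_ge_atTop 1] with κ h1 h2
  simp only [Function.comp] at h2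
  rw [Real.norm_of_nonneg (by linarith), Real.norm_of_nonneg (by positivity), one_mul] at h1
  rw [Real.norm_of_nonneg (by positivity), Real.norm_of_nonneg (by positivity)]
  rw [← Nat.floor_div_eq_div (K := ℝ)]
  have h3 := Nat.lt_floor_add_one ((κ : ℝ) / (q' κ : ℝ))
  have h4 : (1 : ℝ) ≤ (⌊(κ : ℝ) / (q' κ : ℝ)⌋₊ : ℝ) := by
    exact_mod_cast Nat.le_floor (by push_cast; linarith)
  linarith

/-- If the dynamic memory holds at least half a word, then there are many samples. -/
theorem eventually_pow_le_two_pow_samples {q' : ℕ → ℕ} {Λ : ℕ → ℝ}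
    (hΛ : (fun κ => Real.log (Λ κ)) =o[atTop] fun κ => (q' κ : ℝ))
    (h : (fun κ : ℕ => Real.log κ) =o[atTop] fun κ : ℕ => (κ : ℝ) / (q' κ : ℝ)) (e : ℕ) :
    ∀ᶠ κ : ℕ in atTop, ((κ / q' κ : ℕ) : ℝ) ≤ 2 * Λ κ → (κ : ℝ) ^ e ≤ 2 ^ (q' κ : ℝ) := by
  have hlog2 : 0 < Real.log 2 := Real.log_pos (by norm_num)
  have hsqrt : (fun κ : ℕ => Real.log κ) =o[atTop] fun κ : ℕ => (κ : ℝ) ^ (1 / 2 : ℝ) :=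
    (isLittleO_log_rpow_atTop (by norm_num)).comp_tendsto tendsto_natCast_atTop_atTop
  have hquart : Tendsto (fun κ : ℕ => (κ : ℝ) ^ (1 / 4 : ℝ)) atTop atTop :=
    (tendsto_rpow_atTop (by norm_num)).comp tendsto_natCast_atTop_atTop
  filter_upwards [hΛ.def (show 0 < Real.log 2 / (4 * (e + 1)) by positivity),
    eventually_pow_le_two_rpow hsqrt e (Eventually.of_forall fun κ => by positivity),
    hquart.eventually_ge_atTop 4, eventually_gt_atTop 0, h.def one_pos,
    (Real.tendsto_log_atTop.comp tendsto_natCast_atTop_atTop).eventually_ge_atTop 1]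
    with κ h1 h2 h3 h4 h5 h5' h6
  simp only [Function.comp] at h5'
  have h4' : (0 : ℝ) < κ := by exact_mod_cast h4
  -- If `q'` is below `√κ`, words have about `√κ` bits or more, so `Λ ≥ κ ^ (1 / 4)` and `q'`
  -- dominates `log κ` because it dominates `log Λ`.
  by_cases hq : (κ : ℝ) ^ (1 / 2 : ℝ) ≤ q' κ
  · exact h2.trans (Real.rpow_le_rpow_of_exponent_le (by norm_num) hq)
  · push Not at hq
    have hq0 : (0 : ℝ) < q' κ := by
      rcases Nat.eq_zero_or_pos (q' κ) with h0 | h0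
      · rw [h0, Real.norm_of_nonneg (by linarith)] at h5
        simp at h5
        linarith
      · exact_mod_cast h0
    have hx : (κ : ℝ) ^ (1 / 2 : ℝ) = ((κ : ℝ) ^ (1 / 4 : ℝ)) ^ 2 := by
      rw [← Real.rpow_natCast, ← Real.rpow_mul h4'.le]; norm_num
    have hxx : (κ : ℝ) = (κ : ℝ) ^ (1 / 2 : ℝ) * (κ : ℝ) ^ (1 / 2 : ℝ) := by
      rw [← Real.rpow_add h4']; norm_num
    have h7 : (κ : ℝ) ^ (1 / 2 : ℝ) ≤ (κ : ℝ) / q' κ := by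
      rw [le_div_iff₀ hq0]
      calc _ ≤ (κ : ℝ) ^ (1 / 2 : ℝ) * (κ : ℝ) ^ (1 / 2 : ℝ) := by gcongr
        _ = _ := hxx.symm
    rw [← Nat.floor_div_eq_div (K := ℝ)] at h6
    have h8 := Nat.lt_floor_add_one ((κ : ℝ) / (q' κ : ℝ))
    have h9 : (κ : ℝ) ^ (1 / 4 : ℝ) ≤ Λ κ := by nlinarith
    have h10 : 1 / 4 * Real.log κ ≤ Real.log (Λ κ) := by
      rw [← Real.log_rpow h4']
      exact Real.log_le_log (by positivity) h9
    rw [Real.norm_of_nonneg (by linarith), Real.norm_of_nonneg hq0.le, div_mul_eq_mul_div,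
      le_div_iff₀ (by positivity)] at h1
    rw [← Real.log_le_log_iff (by positivity) (by positivity), Real.log_pow,
      Real.log_rpow (by norm_num)]
    nlinarith

/-- The bound for the success probability by compression. -/
theorem compression_bound_le {P m k n ℓ : ℕ} (hk : 0 < k) (hm : 2 * m ≤ k * ℓ)
    (hM : ((n * ((n * (P * P) + 1) * (P * P + 1)) : ℕ) : ℝ) ≤ 2 ^ ((ℓ : ℝ) / 8)) :
    (((P + 1) * (2 * (2 ^ (m + 1) * (n * ((n * (P * P) + 1) * (P * P + 1))) ^ k)) : ℕ) : ℝ) /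
      2 ^ (ℓ * k) ≤ 4 * (P + 1) / 2 ^ ((ℓ : ℝ) / 8) := by
  set M := n * ((n * (P * P) + 1) * (P * P + 1))
  -- In units of `y`, the state costs at most `y ^ (4 * k)`, the pointers cost at most `y ^ k`, and
  -- the payload gains `y ^ (8 * k)`.
  set y : ℝ := 2 ^ ((ℓ : ℝ) / 8) with hy
  have hy1 : 1 ≤ y := Real.one_le_rpow (by norm_num) (by positivity)
  have hpow : ∀ j : ℕ, y ^ j = 2 ^ ((ℓ : ℝ) / 8 * j) := fun j => by
    rw [hy, Real.rpow_mul (by norm_num), Real.rpow_natCast]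
  have h2m : (2 : ℝ) ^ m ≤ y ^ (4 * k) := by
    rw [hpow, ← Real.rpow_natCast]
    refine Real.rpow_le_rpow_of_exponent_le (by norm_num) ?_
    have : (2 * m : ℝ) ≤ k * ℓ := by exact_mod_cast hm
    push_cast
    linarith
  have hlk : (2 : ℝ) ^ (ℓ * k) = y ^ (8 * k) := by
    rw [hpow, ← Real.rpow_natCast]
    congr 1
    push_cast
    ring
  rw [hlk, div_le_div_iff₀ (by positivity) (by positivity)]
  push_cast
  calc ((P : ℝ) + 1) * (2 * (2 ^ (m + 1) * (M : ℝ) ^ k)) * y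
      ≤ ((P : ℝ) + 1) * (2 * ((2 * y ^ (4 * k)) * y ^ k)) * y := by
        rw [pow_succ' 2 m]
        gcongr
    _ = 4 * (P + 1) * y ^ (5 * k + 1) := by ring
    _ ≤ 4 * (P + 1) * y ^ (8 * k) := by
        gcongr
        omega

/-- Few samples are improbable if the dynamic memory holds at least half a word. -/
theorem card_few_samples_le {G : Dag} {κ ℓ N q q' : ℕ} (hN : 0 < N) (hqN : 8 * q ≤ N)
    (hNℓ : N ≤ 2 ^ ℓ) (hq : q' * ℓ ≤ κ) (hq0 : 0 < q) (hN2 : N ^ 2 ≤ 2 ^ q')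
    (X : Finset (BitVec κ)) (hX : X.card = q) :
    (Nat.card {O : OracleInput G κ ℓ → BitVec κ | (samples O N q' X).card < 2 * q} : ℝ) ≤
      (N : ℝ) ^ 2 / 2 ^ q' * Nat.card (OracleInput G κ ℓ → BitVec κ) := by
  have hfin : Finite (OracleInput G κ ℓ) := OracleInput.finite G κ ℓ
  have := BitVec.finite κ
  have h1 := card_few_samples_mul_le (G := G) hN (k := 2 * q) (by omega) hNℓ hq X
  have h2 : Nat.card {O : OracleInput G κ ℓ → BitVec κ | (samples O N q' X).card < 2 * q} ≤
      Nat.card {O : OracleInput G κ ℓ → BitVec κ | (samples O N q' X).card ≤ 2 * q} :=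
    Set.ncard_le_ncard (fun O hO => le_of_lt (α := ℕ) hO) (Set.toFinite _)
  rw [hX, pow_mul, pow_mul, mul_comm] at h1
  have h3 : ((N : ℝ) ^ 2 / 2 ^ q') ^ q ≤ (N : ℝ) ^ 2 / 2 ^ q' := by
    refine pow_le_of_le_one (by positivity) ?_ (by omega)
    rw [div_le_one (by positivity)]
    exact_mod_cast hN2
  refine le_trans ?_ (mul_le_mul_of_nonneg_right h3 (Nat.cast_nonneg _))
  rw [div_pow, div_mul_eq_mul_div, le_div_iff₀ (by positivity), mul_comm]
  refine le_trans (mul_le_mul_of_nonneg_left (Nat.cast_le.mpr h2) (by positivity)) ?_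
  exact_mod_cast h1

/-! ### The main theorem -/

theorem mainTheorem1 (c₁ : ℕ) (hc₁ : 2 ≤ c₁) :
    ∃ c : ℝ, 0 < c ∧
    ∀ (s : ℕ → ℕ) (root : ℕ → ℕ → ℕ) (ζ : ∀ κ, BitVec κ) (q' : ℕ → ℕ) (Λ : ℕ → ℝ) (lam : ℝ),
      (∀ κ, 2 ≤ s κ) →
      (∀ κ i, 2 ≤ i → i ≤ s κ → PNode.IsCell (s κ) i (root κ i)) →
      (∃ a : ℕ, (fun κ : ℕ => (s κ : ℝ)) =O[Filter.atTop] fun κ : ℕ => (κ : ℝ) ^ a) →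
      0 ≤ lam →
      (Λ =Θ[Filter.atTop] fun κ => √(Nat.card (hardGraph (s κ) c₁ (root κ)).V : ℝ)) →
      ((fun κ => Real.log (Λ κ)) =o[Filter.atTop] fun κ => (q' κ : ℝ)) →
      ((fun κ : ℕ => Real.log κ) =o[Filter.atTop] fun κ : ℕ => (κ : ℝ) / (q' κ : ℝ)) →
      (graphSHF c₁ s root ζ q').IsHard
        (fun κ => Λ κ - lam)
        (fun κ => c * (Nat.card (hardGraph (s κ) c₁ (root κ)).V : ℝ))
        (fun κ => ⌈Λ κ / ((κ / q' κ : ℕ) : ℝ)⌉₊) := by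
  -- From `n ≤ (c₁ + 9) * s ^ 2` and `s ≤ 16 * (s / 8)` it follows that `c * n ≤ (s / 8) ^ 2`,
  -- within the allowed `2 * (s / 8) ^ 2`.
  refine ⟨1 / (256 * (c₁ + 9)), by positivity, ?_⟩
  intro s root ζ q' Λ lam hs hroot ⟨a, hsa⟩ hlam hΛ hq' hκq' Δ hΔ A ⟨p, hp⟩
  obtain ⟨d, hd⟩ := p.exists_eval_le_pow
  set n : ℕ → ℕ := fun κ => Nat.card (hardGraph (s κ) c₁ (root κ)).V with hn
  set ℓ : ℕ → ℕ := fun κ => κ / q' κ with hℓdef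
  set m : ℕ → ℕ := fun κ => ⌊Λ κ⌋₊ with hm
  set P : ℕ → ℕ := fun κ => p.eval (κ + m κ) with hPdef
  have hns : ∀ κ, n κ ≤ (c₁ + 9) * s κ ^ 2 := fun κ => HardGraph.card_le c₁ (root κ) (hs κ)
  -- the dynamic memory is at most proportional to the height of the pyramid
  obtain ⟨C, hC0, hC⟩ : ∃ C : ℝ, 0 < C ∧ ∀ᶠ κ in atTop, Λ κ ≤ C * s κ := by
    obtain ⟨C, hC0, hC⟩ := hΛ.1.exists_pos
    refine ⟨C * √(c₁ + 9), by positivity, ?_⟩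
    filter_upwards [hC.bound] with κ h
    rw [Real.norm_of_nonneg (Real.sqrt_nonneg _)] at h
    have h1 : √(n κ : ℝ) ≤ √(c₁ + 9) * s κ := by
      rw [← Real.sqrt_sq (Nat.cast_nonneg (s κ)), ← Real.sqrt_mul (by positivity)]
      exact Real.sqrt_le_sqrt (by exact_mod_cast hns κ)
    calc Λ κ ≤ ‖Λ κ‖ := Real.le_norm_self _
      _ ≤ C * √(n κ : ℝ) := h
      _ ≤ C * (√(c₁ + 9) * s κ) := by gcongr
      _ = _ := by ring
  have hlarge : ∀ x : ℝ, ∀ᶠ κ : ℕ in atTop, x ≤ κ := fun x =>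
    tendsto_natCast_atTop_atTop.eventually_ge_atTop x
  have hlogtop : Tendsto (fun κ : ℕ => Real.log κ) atTop atTop :=
    Real.tendsto_log_atTop.comp tendsto_natCast_atTop_atTop
  have hspoly : ∀ᶠ κ : ℕ in atTop, (s κ : ℝ) ≤ (κ : ℝ) ^ (a + 1) := by
    obtain ⟨D, hD⟩ := hsa.bound
    filter_upwards [hD, hlarge D] with κ h1 h2
    rw [Real.norm_of_nonneg (by positivity), Real.norm_of_nonneg (by positivity)] at h1
    rw [pow_succ']
    exact h1.trans (by gcongr)
  -- polynomial bounds
  have hmpoly : ∀ᶠ κ : ℕ in atTop, ((κ + m κ : ℕ) : ℝ) ≤ (κ : ℝ) ^ (a + 3) := by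
    filter_upwards [hC, hspoly, hlarge C, hlarge 2] with κ h1 h2 h3 h4
    have h5 : (m κ : ℝ) ≤ (κ : ℝ) ^ (a + 2) := by
      have : (m κ : ℝ) ≤ C * s κ :=
        (Nat.cast_le.mpr (Nat.floor_le_floor h1)).trans (Nat.floor_le (by positivity))
      calc (m κ : ℝ) ≤ C * s κ := this
        _ ≤ κ * (κ : ℝ) ^ (a + 1) := by gcongr
        _ = _ := by ring
    have h6 : (κ : ℝ) ≤ (κ : ℝ) ^ (a + 2) := le_self_pow₀ (by linarith) (by omega)
    push_cast
    calc (κ : ℝ) + m κ ≤ 2 * (κ : ℝ) ^ (a + 2) := by linarith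
      _ ≤ κ * (κ : ℝ) ^ (a + 2) := by gcongr
      _ = _ := by ring
  have hPpoly : ∀ᶠ κ : ℕ in atTop, (P κ : ℝ) ≤ (κ : ℝ) ^ ((a + 3) * d) := by
    filter_upwards [hmpoly, hlarge 2] with κ h1 h2
    have h2' : 2 ≤ κ := by exact_mod_cast h2
    have h3 : (P κ : ℝ) ≤ ((κ + m κ : ℕ) : ℝ) ^ d := by exact_mod_cast hd _ (by omega)
    rw [pow_mul]
    exact h3.trans (by gcongr)
  have hnpoly : ∀ᶠ κ : ℕ in atTop, (n κ : ℝ) ≤ (κ : ℝ) ^ (2 * a + 3) := by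
    filter_upwards [hspoly, hlarge (c₁ + 9)] with κ h1 h2
    calc (n κ : ℝ) ≤ (c₁ + 9) * (s κ : ℝ) ^ 2 := by exact_mod_cast hns κ
      _ ≤ κ * ((κ : ℝ) ^ (a + 1)) ^ 2 := by gcongr
      _ = _ := by ring
  have hℓlog : (fun κ : ℕ => Real.log κ) =o[atTop] fun κ : ℕ => (ℓ κ : ℝ) :=
    isLittleO_log_word hκq'
  have hℓ8 : ∀ e : ℕ, ∀ᶠ κ : ℕ in atTop, (κ : ℝ) ^ e ≤ 2 ^ ((ℓ κ : ℝ) / 8) := fun e => by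
    refine eventually_pow_le_two_rpow ?_ e (Eventually.of_forall fun κ => by positivity)
    simp_rw [div_eq_mul_inv]
    exact hℓlog.trans_isBigO (isBigO_self_const_mul (by norm_num : (8 : ℝ)⁻¹ ≠ 0) _ _ |>.congr_right
      fun κ => mul_comm _ _)
  have hℓlarge : ∀ x : ℝ, ∀ᶠ κ : ℕ in atTop, x ≤ ℓ κ := fun x => by
    filter_upwards [hℓlog.def one_pos, hlogtop.eventually_ge_atTop x] with κ h1 h2
    rw [Real.norm_of_nonneg (Nat.cast_nonneg _), one_mul] at h1
    exact h2.trans ((Real.le_norm_self _).trans h1)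
  have hsamples := eventually_pow_le_two_pow_samples hq' hκq'
  have hMpoly : ∀ᶠ κ : ℕ in atTop,
      ((n κ * ((n κ * (P κ * P κ) + 1) * (P κ * P κ + 1)) : ℕ) : ℝ) ≤ 2 ^ ((ℓ κ : ℝ) / 8) := by
    filter_upwards [hnpoly, hPpoly, hlarge 2, hℓ8 (4 * a + 8 + 4 * ((a + 3) * d))]
      with κ h1 h2 h3 h4
    refine le_trans ?_ h4
    set b := (a + 3) * d
    have hb : (1 : ℝ) ≤ (κ : ℝ) ^ (2 * b) := one_le_pow₀ (by linarith)
    have hb' : (1 : ℝ) ≤ (κ : ℝ) ^ (2 * a + 3 + 2 * b) := one_le_pow₀ (by linarith)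
    have hPP : (P κ : ℝ) * P κ ≤ (κ : ℝ) ^ (2 * b) := by
      calc (P κ : ℝ) * P κ ≤ (κ : ℝ) ^ b * (κ : ℝ) ^ b := by gcongr
        _ = _ := by ring
    have e1 : (n κ : ℝ) * (P κ * P κ) + 1 ≤ κ * (κ : ℝ) ^ (2 * a + 3 + 2 * b) := by
      calc (n κ : ℝ) * (P κ * P κ) + 1 ≤ (κ : ℝ) ^ (2 * a + 3) * (κ : ℝ) ^ (2 * b) + 1 := by gcongr
        _ = (κ : ℝ) ^ (2 * a + 3 + 2 * b) + 1 := by ring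
        _ ≤ 2 * (κ : ℝ) ^ (2 * a + 3 + 2 * b) := by linarith
        _ ≤ _ := by gcongr
    have e2 : (P κ : ℝ) * P κ + 1 ≤ κ * (κ : ℝ) ^ (2 * b) := by
      calc (P κ : ℝ) * P κ + 1 ≤ 2 * (κ : ℝ) ^ (2 * b) := by linarith
        _ ≤ _ := by gcongr
    push_cast
    calc (n κ : ℝ) * ((n κ * (P κ * P κ) + 1) * (P κ * P κ + 1)) ≤
        (κ : ℝ) ^ (2 * a + 3) * ((κ * (κ : ℝ) ^ (2 * a + 3 + 2 * b)) *
          (κ * (κ : ℝ) ^ (2 * b))) := by gcongr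
      _ = _ := by ring
  -- the bound
  let ε₁ : ℕ → ℝ := fun κ => 4 * (P κ + 1) / 2 ^ ((ℓ κ : ℝ) / 8)
  let ε₂ : ℕ → ℝ := fun κ => if (ℓ κ : ℝ) ≤ 2 * Λ κ then (s κ : ℝ) ^ 2 / 2 ^ q' κ else 0
  let ε₃ : ℕ → ℝ := fun κ => 1 / 2 ^ κ
  have hε₂0 : ∀ κ, 0 ≤ ε₂ κ := fun κ => by
    simp only [ε₂]; split_ifs <;> positivity
  refine ⟨fun κ => ε₁ κ + ε₂ κ + ε₃ κ, ?_, ?_⟩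
  · refine ((superpolynomialDecay_of_le (f := ε₁) (fun κ => by positivity) fun b => ?_).add
      (superpolynomialDecay_of_le (f := ε₂) hε₂0 fun b => ?_)).add
      (superpolynomialDecay_of_le (f := ε₃) (fun κ => by positivity) fun b => ?_)
    · filter_upwards [hPpoly, hlarge 8, hℓ8 (b + 1 + (a + 3) * d)] with κ h1 h2 h3
      have hb : (1 : ℝ) ≤ (κ : ℝ) ^ ((a + 3) * d) := one_le_pow₀ (by linarith)
      simp only [ε₁]
      rw [← mul_div_assoc, div_le_one (by positivity)]
      calc (κ : ℝ) ^ b * (4 * (P κ + 1)) ≤ (κ : ℝ) ^ b * (8 * (κ : ℝ) ^ ((a + 3) * d)) := by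
            exact mul_le_mul_of_nonneg_left (by linarith) (by positivity)
        _ ≤ (κ : ℝ) ^ b * (κ * (κ : ℝ) ^ ((a + 3) * d)) := by gcongr
        _ = (κ : ℝ) ^ (b + 1 + (a + 3) * d) := by ring
        _ ≤ _ := h3
    · filter_upwards [hsamples (b + 2 * (a + 1)), hspoly] with κ h1 h2
      simp only [ε₂]
      split_ifs with hif
      · have h1 := h1 hif
        rw [Real.rpow_natCast] at h1
        rw [← mul_div_assoc, div_le_one (by positivity)]
        calc (κ : ℝ) ^ b * (s κ : ℝ) ^ 2 ≤ (κ : ℝ) ^ b * ((κ : ℝ) ^ (a + 1)) ^ 2 := by gcongr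
          _ = (κ : ℝ) ^ (b + 2 * (a + 1)) := by ring
          _ ≤ _ := h1
      · simp
    · have hlogκ : (fun κ : ℕ => Real.log κ) =o[atTop] fun κ : ℕ => (κ : ℝ) :=
        Real.isLittleO_log_id_atTop.comp_tendsto tendsto_natCast_atTop_atTop
      filter_upwards [eventually_pow_le_two_rpow hlogκ b
        (Eventually.of_forall fun κ => Nat.cast_nonneg _)] with κ h1
      rw [Real.rpow_natCast] at h1
      simp only [ε₃]
      rw [mul_one_div, div_le_one (by positivity)]
      exact h1
  -- Only the divergence of `Δ` matters, as the compression has a factor of two to spare.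
  have hΔlarge : ∀ x : ℝ, ∀ᶠ κ : ℕ in atTop, x ≤ Δ κ := fun x => by
    filter_upwards [hΔ.eventually_ge_atTop 1, hlogtop.eventually_ge_atTop (max x 1)] with κ h1 h2
    have h3 : (1 : ℝ) ≤ Real.log κ := (le_max_right _ _).trans h2
    rw [le_div_iff₀ (by linarith), one_mul] at h1
    exact (le_max_left _ _).trans (h2.trans h1)
  filter_upwards [hC, hΔlarge 1, hΔlarge (C * 64), hMpoly, hspoly, hsamples (2 * (a + 1)),
    hℓ8 (a + 1), hℓlarge (384 * C), hℓlarge 1] with κ hCκ hΔ1 hΔC hMκ hsκ hsamp hℓs hℓC hℓ1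
  intro X hX R hR
  set G := hardGraph (s κ) c₁ (root κ) with hG
  change (OracleInput G κ (ℓ κ) → BitVec κ) → List Bool at R
  -- The existence of an admissible static string forces `Λ`, and through `Λ ≤ C * s` also `s`, to
  -- be large.
  have hΛΔ : Δ κ ≤ Λ κ := by
    have h1 := hR fun _ => 0
    have h2 : (0 : ℝ) ≤ ((R fun _ => 0).length : ℝ) := Nat.cast_nonneg _
    linarith
  have hs64 : 64 ≤ s κ := by
    have : C * 64 ≤ C * s κ := by linarith
    exact_mod_cast le_of_mul_le_mul_left this hC0
  have hRm : ∀ O, (R O).length ≤ m κ := by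
    intro O
    refine Nat.le_floor ?_
    have := hR O
    linarith
  have hP : ∀ O ρ, ((A κ).run O (R O) ρ (P κ)).halted = true ∧
      ((A κ).run O (R O) ρ (P κ)).queries ≤ P κ := by
    intro O ρ
    obtain ⟨h1, h2⟩ := hp κ O (R O) ρ
    have hle : p.eval (κ + (R O).length) ≤ P κ :=
      p.eval_mono_nat (Nat.add_le_add_left (hRm O) κ)
    rw [PromAlgorithm.run_of_halted h1 hle]
    exact ⟨h1, h2.trans hle⟩
  have hN : sinkCount G = s κ := HardGraph.card_sinks (hs κ) (by omega) (hroot κ)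
  have hNℓ : s κ ≤ 2 ^ ℓ κ := by
    have h1 : (2 : ℝ) ^ ((ℓ κ : ℝ) / 8) ≤ 2 ^ (ℓ κ : ℝ) :=
      Real.rpow_le_rpow_of_exponent_le (by norm_num) (by
        have : (0 : ℝ) ≤ ℓ κ := Nat.cast_nonneg _
        linarith)
    rw [Real.rpow_natCast] at h1
    exact_mod_cast hsκ.trans (hℓs.trans h1)
  have hℓ0 : (0 : ℝ) < ℓ κ := by linarith
  have hq0 : 0 < ⌈Λ κ / (ℓ κ : ℝ)⌉₊ := Nat.ceil_pos.mpr (div_pos (by linarith) hℓ0)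
  have hq'0 : 0 < q' κ := by
    rcases Nat.eq_zero_or_pos (q' κ) with h0 | h0
    · simp [hℓdef, h0] at hℓ0
    · exact h0
  have hqℓ : q' κ * ℓ κ ≤ κ := Nat.mul_div_le _ _
  set q := ⌈Λ κ / (ℓ κ : ℝ)⌉₊ with hq
  -- the number of labels that cannot be predicted
  obtain ⟨k, hk0, hk8, hkm, hkfew⟩ : ∃ k, 0 < k ∧ k ≤ s κ / 8 ∧ 2 * m κ ≤ k * ℓ κ ∧
      (Nat.card {O : OracleInput G κ (ℓ κ) → BitVec κ |
        (samples O (sinkCount G) (q' κ) X).card < k} : ℝ) ≤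
        ε₂ κ * Nat.card (OracleInput G κ (ℓ κ) → BitVec κ) := by
    have hmΛ : (m κ : ℝ) ≤ Λ κ := Nat.floor_le (by linarith)
    by_cases hcase : (ℓ κ : ℝ) ≤ 2 * Λ κ
    · have hqΛ : Λ κ ≤ q * ℓ κ := by
        have := Nat.le_ceil (Λ κ / (ℓ κ : ℝ))
        rwa [div_le_iff₀ hℓ0] at this
      -- By the case assumption `q * ℓ < Λ + ℓ ≤ 3 * C * s`, and `ℓ ≥ 384 * C`.
      have hq64 : 64 * q ≤ s κ := by
        have h1 : (q : ℝ) < Λ κ / ℓ κ + 1 := Nat.ceil_lt_add_one (by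
          exact div_nonneg (by linarith) hℓ0.le)
        have h2 : (q : ℝ) * ℓ κ < Λ κ + ℓ κ := by
          calc (q : ℝ) * ℓ κ < (Λ κ / ℓ κ + 1) * ℓ κ := by gcongr
            _ = _ := by field_simp
        have h3 : (64 * q : ℝ) * (384 * C) ≤ s κ * (384 * C) := by
          have h4 : (q : ℝ) * (384 * C) ≤ q * ℓ κ := by gcongr
          have h5 : 0 ≤ C * s κ := by positivity
          nlinarith
        exact_mod_cast le_of_mul_le_mul_right h3 (by positivity)
      -- `2 * q` labels carry at least `2 * Λ` bits, twice what a small state can hold.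
      refine ⟨2 * q, by omega, by omega, ?_, ?_⟩
      · have : (2 * m κ : ℝ) ≤ 2 * q * ℓ κ := by nlinarith
        exact_mod_cast this
      · simp only [ε₂, if_pos hcase]
        rw [hN]
        refine card_few_samples_le (by omega) (by omega) hNℓ hqℓ hq0 ?_ X hX
        have h1 := hsamp hcase
        rw [Real.rpow_natCast] at h1
        have h2 : (s κ : ℝ) ^ 2 ≤ 2 ^ q' κ := by
          calc (s κ : ℝ) ^ 2 ≤ ((κ : ℝ) ^ (a + 1)) ^ 2 := by gcongr
            _ = (κ : ℝ) ^ (2 * (a + 1)) := by ring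
            _ ≤ _ := h1
        exact_mod_cast h2
    -- If the memory is below half a word, predicting a single label is already unlikely, and at
    -- least one position is always sampled.
    · refine ⟨1, one_pos, by omega, ?_, ?_⟩
      · have : (2 * m κ : ℝ) ≤ 1 * ℓ κ := by linarith
        exact_mod_cast this
      · simp only [ε₂, if_neg hcase, zero_mul]
        have : {O : OracleInput G κ (ℓ κ) → BitVec κ |
            (samples O (sinkCount G) (q' κ) X).card < 1} = ∅ := by
          ext O
          simp only [Set.mem_ofPred_eq, Set.mem_empty_iff_false, iff_false, not_lt]
          obtain ⟨x, hx⟩ := Finset.card_pos.mp (show 0 < X.card by rw [hX]; exact hq0)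
          exact Finset.card_pos.mpr ⟨_, mem_samples.mpr ⟨x, hx, 0, hq'0, rfl⟩⟩
        rw [this]
        simp
  have hτ : 1 / (256 * ((c₁ : ℝ) + 9)) * (n κ : ℝ) ≤ 2 * (s κ / 8 : ℕ) * (s κ / 8 : ℕ) := by
    have h1 : (n κ : ℝ) ≤ (c₁ + 9) * (s κ : ℝ) ^ 2 := by exact_mod_cast hns κ
    have h2 : (s κ : ℝ) ≤ 16 * (s κ / 8 : ℕ) := by
      exact_mod_cast (show s κ ≤ 16 * (s κ / 8) by omega)
    rw [div_mul_eq_mul_div, one_mul, div_le_iff₀ (by positivity)]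
    calc (n κ : ℝ) ≤ (c₁ + 9) * (s κ : ℝ) ^ 2 := h1
      _ ≤ (c₁ + 9) * (16 * (s κ / 8 : ℕ)) ^ 2 := by gcongr
      _ ≤ _ := by
        have : (0 : ℝ) ≤ (c₁ + 9) * ((s κ / 8 : ℕ) : ℝ) ^ 2 := by positivity
        nlinarith
  have hmain := unifProb_success_le (h := s κ / 8) (P := P κ) (m := m κ) (q' := q' κ)
    (L := Λ κ - lam) (hs κ) (by omega) (hroot κ) (by omega) hk0 hk8 (Nat.div_le_self _ _) hqℓ
    (ζ κ) (A κ) R X hP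
    (fun O => by
      have := hR O
      linarith)
    (by
      have := Nat.lt_floor_add_one (Λ κ)
      simp only [hm]
      linarith) hτ (hε₂0 κ) hkfew
  have hcomp := compression_bound_le (P := P κ) (n := n κ) hk0 hkm hMκ
  have hε₃ : 0 < ε₃ κ := by simp only [ε₃]; positivity
  refine lt_of_le_of_lt (hmain.trans (add_le_add_left hcomp _)) ?_
  change ε₁ κ + ε₂ κ < ε₁ κ + ε₂ κ + ε₃ κ
  linarith
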